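/- Let $k\ge 0$ and $n\ge k+2$ be integers, and put $m_1=\binom{n-2}{k-1}$ (so $m_1=0$ for $k=0$) and $m_3=\binom{n-1}{k}$. Let $T$ be a $k$-dimensional $\mathbb{Q}$-acyclic simplicial complex on the vertex set $[n]=\{1,\dots,n\}$; that is, $T$ contains every nonempty subset of $[n]$ with at most $k$ elements (a full $(k-1)$-skeleton), has exactly $m_3$ faces of dimension $k$ and no faces of larger dimension, and satisfies $\tilde H_k(T;\mathbb{Q})=0$. Let $d_1\le d_2\le\dots\le d_n$ be the degrees of the vertices of $T$ in increasing order, where the degree of a vertex is the number of $k$-dimensional faces of $T$ that contain it. Then the reduced integral homology group $\tilde H_{k-1}(T)=\tilde H_{k-1}(T;\mathbb{Z})$ is finite; there is an index $i$ with $d_i>m_1$, and we let $i_*$ be the smallest such index; and $$\left[\tfrac{d_{i_*}}{m_3},\tfrac{d_n}{m_3}\right]\subseteq\left(\tfrac{k}{n-1},1\right].$$ The equation $$\sum_{i=1}^n\frac{d_i-m_1}{d_i-m_1\alpha}=\alpha^{-1}$$ (in which terms with $d_i=m_1$ are read as $0$) has exactly one solution $\alpha$ in $\left(\frac{k}{n-1},1\right]$,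 this solution lies in $\left[\frac{d_{i_*}}{m_3},\frac{d_n}{m_3}\right]$, and $$|\tilde H_{k-1}(T)|^2\le\alpha^{m_1}\prod_{i=i_*}^n\left(1+\frac{(1-\alpha)m_1}{d_i-m_1}\right)^{d_i-m_1}\le\left(\alpha e^{(1-\alpha)(n-i_*+1)}\right)^{m_1}\le e^{(1-\alpha)(n-i_*)m_1}.$$ Moreover, the number $\alpha^{m_1}\prod_{i=i_*}^n\left(1+\frac{(1-\alpha)m_1}{d_i-m_1}\right)^{d_i-m_1}$ is the infimum of the function $$f(x)=\frac{\prod_{i=1}^n(x_i^2)^{m_1-d_i}}{\left(\sum_{i=1}^n x_i^2\right)^{m_1}}\left(\frac{\sum_{i=1}^n d_i x_i^2}{m_3}\right)^{m_3}$$ over all $x\in(\mathbb{R}\setminus\{0\})^n$, and it is the minimum of $f$ (attained) over all $x\in\mathbb{R}^n$ such that $x_i\neq0$ whenever $d_i>m_1$, where $0^0=1$. -/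

import Mathlib

namespace TorsionBound

variable {n : ℕ}

/-- The faces of `T` with exactly `c` vertices, that is, of dimension `c - 1`. The empty set is
the unique face of dimension `-1`, as in the augmented (reduced) chain complex. -/
abbrev Face (T : PreAbstractSimplicialComplex (Fin n)) (c : ℕ) : Type :=
  {s : Finset (Fin n) // s.card = c ∧ (s ∈ T.faces ∨ s = ∅)}

noncomputable instance (T : PreAbstractSimplicialComplex (Fin n)) (c : ℕ) : Fintype (Face T c) :=
  Fintype.ofFinite _

/-- The incidence number of `σ` in the boundary of `τ = {τ_0 < τ_1 < ⋯}`: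
it is `(-1) ^ m` if `σ = τ \ {τ_m}`, and `0` if `σ` is not of this form. -/
def incidence (σ τ : Finset (Fin n)) : ℤ :=
  ∑ v ∈ τ, if σ = τ.erase v then (-1) ^ (τ.filter (fun u => u < v)).card else 0

/-- The simplicial boundary map from chains on faces with `c + 1` vertices to chains on faces
with `c` vertices, coefficients in `R`. -/
noncomputable def boundary (R : Type) [CommRing R] (T : PreAbstractSimplicialComplex (Fin n))
    (c : ℕ) : (Face T (c + 1) → R) →ₗ[R] (Face T c → R) :=
  Matrix.mulVecLin (Matrix.of fun σ τ => ((incidence σ.1 τ.1 : ℤ) : R))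

/-- The cycles among the chains on faces with `c` vertices. -/
noncomputable def cycles (R : Type) [CommRing R] (T : PreAbstractSimplicialComplex (Fin n)) :
    (c : ℕ) → Submodule R (Face T c → R)
  | 0 => ⊤
  | c + 1 => LinearMap.ker (boundary R T c)

/-- `ReducedHomology R T c` is the reduced simplicial homology group of `T` with coefficients
in `R` in dimension `c - 1`: cycles modulo boundaries among the chains on faces with
`c` vertices. -/
abbrev ReducedHomology (R : Type) [CommRing R] (T : PreAbstractSimplicialComplex (Fin n))
    (c : ℕ) : Type :=
  cycles R T c ⧸ (LinearMap.range (boundary R T c)).submoduleOf (cycles R T c)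

/-- The faces of `T` of dimension `k`. -/
def kFaces (T : PreAbstractSimplicialComplex (Fin n)) (k : ℕ) : Set (Finset (Fin n)) :=
  {s | s ∈ T.faces ∧ s.card = k + 1}

/-- `T` is a `k`-dimensional `ℚ`-acyclic simplicial complex on `n` vertices: its dimension is at
most `k`, it has a full `(k - 1)`-skeleton, it has `(n - 1).choose k` faces of dimension `k`, and
its `k`-th (reduced) rational homology vanishes. -/
structure IsQAcyclic (T : PreAbstractSimplicialComplex (Fin n)) (k : ℕ) : Prop where
  card_le : ∀ s ∈ T.faces, s.card ≤ k + 1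
  full_skeleton : ∀ s : Finset (Fin n), s.Nonempty → s.card ≤ k → s ∈ T.faces
  ncard_kFaces : (kFaces T k).ncard = (n - 1).choose k
  homology_eq_zero : Subsingleton (ReducedHomology ℚ T (k + 1))

/-- The number of `k`-dimensional faces of `T` that contain the vertex `i`. -/
noncomputable def degree (T : PreAbstractSimplicialComplex (Fin n)) (k : ℕ) (i : Fin n) : ℕ :=
  {s | s ∈ kFaces T k ∧ i ∈ s}.ncard

/-- The binomial coefficient `n - 2` over `k - 1`, which is `0` for `k = 0`. -/
def m₁ (n : ℕ) : ℕ → ℕ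
  | 0 => 0
  | k + 1 => (n - 2).choose k

/-- The binomial coefficient `n - 1` over `k`. -/
def m₃ (n k : ℕ) : ℕ := (n - 1).choose k

/-- The bound on `|H̃_{k-1}(T)|²` after the AM-GM inequality, as a function of `x ∈ ℝⁿ`, for
a degree sequence `d`:
`∏ᵢ (xᵢ²)^(m₁ - dᵢ) / (∑ᵢ xᵢ²)^m₁ * ((∑ᵢ dᵢ xᵢ²) / m₃)^m₃`, where `0 ^ 0 = 1`. -/
noncomputable def relaxedBound (k : ℕ) (d : Fin n → ℕ) (x : Fin n → ℝ) : ℝ :=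
  (∏ i, (x i ^ 2) ^ ((m₁ n k : ℤ) - (d i : ℤ))) / (∑ i, x i ^ 2) ^ m₁ n k *
    ((∑ i, (d i : ℝ) * x i ^ 2) / (m₃ n k : ℝ)) ^ m₃ n k

/-- The equation `∑ᵢ (dᵢ - m₁) / (dᵢ - m₁ α) = α⁻¹`; a term with `dᵢ = m₁` is `0`, also when its
denominator vanishes. -/
def SolvesAlpha (k : ℕ) (d : Fin n → ℕ) (α : ℝ) : Prop :=
  ∑ i, ((d i : ℝ) - (m₁ n k : ℝ)) / ((d i : ℝ) - (m₁ n k : ℝ) * α) = α⁻¹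

/-- The product `α^m₁ * ∏_{i ≥ i_*} (1 + (1 - α) m₁ / (dᵢ - m₁))^(dᵢ - m₁)`. -/
noncomputable def productBound (k : ℕ) (d : Fin n → ℕ) (iStar : Fin n) (α : ℝ) : ℝ :=
  α ^ m₁ n k * ∏ i ∈ Finset.Ici iStar,
    (1 + (1 - α) * (m₁ n k : ℝ) / ((d i : ℝ) - (m₁ n k : ℝ))) ^ (d i - m₁ n k)

end TorsionBound

/-! For a vertex `v`, the full `(k-1)`-skeleton contains every cone needed to show that a
`(k-1)`-cycle is determined by its values on the `k`-sets avoiding `v`, and that these values are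
arbitrary. Hence the torsion group is the cokernel of the square boundary matrix with the rows
meeting `v` removed. Rational acyclicity makes its determinant `D` nonzero, so the order is `|D|`.

To bound `D`, weight the boundary by a vector `x`: contraction with `x` on the exterior algebra. Let
`v` be the least vertex, `A` the columns of this operator at the `k`-faces of `T`, `B` the rows of
`A` avoiding `v`, and `C` the columns at the cones `insert v r`. The homotopy formula for
contraction gives `x_v A = C B`. Here `B` is a diagonal rescaling of the reduced matrix, and `CᵀC`
is a scalar matrix plus a multiple of a projection, so its determinant is explicit. Thus `|D|²`
equals `det (AᵀA)` times an explicit monomial in the `x_i²` and `(∑ x_i²)^(-m₁)`. AM-GM on the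
eigenvalues, with trace `∑ d_i x_i²`, yields the bound `f(x)` (`sq_card_reducedHomology_mul_le`).
Letting one `x_i` tend to 0 in this inequality forces `d_i ≥ m₁`.

It remains to minimize `f`. Put `y_i = (d_i - m₁)/(d_i - m₁ α)`. Weighted AM-GM with weight `m₁` on
`α ∑ x_i²` and weights `d_i - m₁` on `x_i²/y_i` bounds `f` below by the product in the theorem.
Equality holds at `x_i² = y_i` once `α ∑ y_i = 1`, which is the equation for `α`. The exponential
bounds are `1 + t ≤ e^t`. -/

namespace TorsionBound

/-! ### Contraction and exterior multiplication: the weighted boundary operator of the full simplex.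
-/

section Koszul

variable {n : ℕ} {R : Type*} [CommRing R]

/-- The sign `(-1) ^ m`, where `m` is the number of elements of `s` below `v`. -/
def sign (R : Type*) [CommRing R] (v : Fin n) (s : Finset (Fin n)) : R :=
  (-1) ^ (s.filter (fun u => u < v)).card

/-- The annihilation operator of `v` on functions on finite sets. -/
def lower (v : Fin n) (f : Finset (Fin n) → R) (s : Finset (Fin n)) : R :=
  if v ∈ s then 0 else sign R v s * f (insert v s)

/-- The creation operator of `v` on functions on finite sets. -/
def raise (v : Fin n) (f : Finset (Fin n) → R) (s : Finset (Fin n)) : R :=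
  if v ∈ s then sign R v s * f (s.erase v) else 0

lemma sign_mul_self (v : Fin n) (s : Finset (Fin n)) : sign R v s * sign R v s = 1 := by
  unfold sign
  rw [← mul_pow]; simp

lemma sign_insert {u v : Fin n} {s : Finset (Fin n)} (hv : v ∉ s) :
    sign R u (insert v s) = (if v < u then -1 else 1) * sign R u s := by
  unfold sign
  rw [Finset.filter_insert]
  split_ifs with h
  · rw [Finset.card_insert_of_notMem (by simp [hv]), pow_succ]; ring
  · simp

lemma sign_erase {u v : Fin n} {s : Finset (Fin n)} (hv : v ∈ s) :
    sign R u (s.erase v) = (if v < u then -1 else 1) * sign R u s := by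
  have h := sign_insert (R := R) (u := u) (Finset.notMem_erase v s)
  rw [Finset.insert_erase hv] at h
  rw [h]
  split_ifs <;> ring

/-- Inserting the smaller of two distinct vertices flips the sign attached to the larger one, and
not conversely, so the two orders differ by a sign. -/
lemma lower_lower (u v : Fin n) (f : Finset (Fin n) → R) :
    lower u (lower v f) + lower v (lower u f) = 0 := by
  ext s
  simp only [lower, Pi.add_apply, Pi.zero_apply]
  by_cases hu : u ∈ s
  · simp [hu]
  by_cases hv : v ∈ s
  · simp [hv]
  rcases eq_or_ne u v with rfl | huv
  · simp [hu]
  simp only [hu, hv, if_false, Finset.mem_insert, huv, huv.symm, false_or, sign_insert,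
    not_false_eq_true, Finset.insert_comm u v s]
  rcases lt_or_gt_of_ne huv with h | h
  · simp only [h, h.not_gt, if_true, if_false]; ring
  · simp only [h, h.not_gt, if_true, if_false]; ring

lemma lower_raise_of_ne {u v : Fin n} (huv : u ≠ v) (f : Finset (Fin n) → R) :
    lower u (raise v f) + raise v (lower u f) = 0 := by
  ext s
  simp only [lower, raise, Pi.add_apply, Pi.zero_apply]
  by_cases hu : u ∈ s
  · simp [hu, huv]
  by_cases hv : v ∈ s
  · simp only [hu, hv, if_false, if_true, Finset.mem_insert, huv.symm, false_or, sign_insert,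
      not_false_eq_true, sign_erase, Finset.mem_erase, and_false,
      Finset.erase_insert_of_ne huv]
    rcases lt_or_gt_of_ne huv with h | h
    · simp only [h, h.not_gt, if_true, if_false]; ring
    · simp only [h, h.not_gt, if_true, if_false]; ring
  · simp [hv, huv.symm]

lemma lower_raise_self (v : Fin n) (f : Finset (Fin n) → R) :
    lower v (raise v f) + raise v (lower v f) = f := by
  ext s
  simp only [lower, raise, Pi.add_apply]
  by_cases hv : v ∈ s
  · simp [hv, sign_erase, ← mul_assoc, sign_mul_self]
  · simp [hv, sign_insert, ← mul_assoc, sign_mul_self]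

/-- The matrix of contraction with the vector `x`, in the basis of the exterior algebra that is
indexed by finite sets. -/
def contraction (x : Fin n → R) : Matrix (Finset (Fin n)) (Finset (Fin n)) R :=
  Matrix.of fun s t => ∑ v ∈ t, if s = t.erase v then sign R v t * x v else 0

lemma contraction_mulVec (x : Fin n → R) (f : Finset (Fin n) → R) :
    (contraction x).mulVec f = ∑ v, x v • lower v f := by
  ext s
  simp only [Matrix.mulVec, dotProduct, contraction, Matrix.of_apply, Finset.sum_apply,
    Pi.smul_apply, smul_eq_mul, lower, Finset.sum_mul]
  have h1 : ∀ t : Finset (Fin n), (∑ v ∈ t, (if s = t.erase v then sign R v t * x v else 0) * f t) =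
      ∑ v, if v ∈ t ∧ s = t.erase v then sign R v t * x v * f t else 0 := by
    intro t
    simp only [ite_and, Finset.sum_ite_mem, Finset.univ_inter, ite_mul, zero_mul]
  simp only [h1]
  rw [Finset.sum_comm]
  refine Finset.sum_congr rfl fun v _ => ?_
  by_cases hv : v ∈ s
  · simp only [hv, if_true, mul_zero]
    refine Finset.sum_eq_zero fun t _ => if_neg ?_
    rintro ⟨-, rfl⟩
    simp at hv
  · rw [Finset.sum_eq_single (insert v s)]
    · simp [hv, sign_insert]; ring
    · intro t _ ht
      refine if_neg ?_
      rintro ⟨h, rfl⟩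
      exact ht (Finset.insert_erase h).symm
    · simp

lemma contraction_transpose_mulVec (x : Fin n → R) (f : Finset (Fin n) → R) :
    (contraction x).transpose.mulVec f = ∑ v, x v • raise v f := by
  ext t
  simp only [Matrix.mulVec, dotProduct, contraction, Matrix.of_apply, Finset.sum_apply,
    Pi.smul_apply, smul_eq_mul, raise, Finset.sum_mul, Matrix.transpose_apply]
  rw [Finset.sum_comm]
  simp only [ite_mul, zero_mul, Finset.sum_ite_eq', Finset.mem_univ, if_true, mul_ite, mul_zero,
    Finset.sum_ite_mem, Finset.univ_inter]
  exact Finset.sum_congr rfl fun v _ => by ring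

lemma lower_sum {ι : Type*} (A : Finset ι) (c : ι → R) (g : ι → Finset (Fin n) → R) (v : Fin n) :
    lower v (∑ i ∈ A, c i • g i) = ∑ i ∈ A, c i • lower v (g i) := by
  ext s
  simp only [lower, Finset.sum_apply, Pi.smul_apply, smul_eq_mul]
  split_ifs
  · simp
  · rw [Finset.mul_sum]; exact Finset.sum_congr rfl fun _ _ => by ring

lemma raise_sum {ι : Type*} (A : Finset ι) (c : ι → R) (g : ι → Finset (Fin n) → R) (v : Fin n) :
    raise v (∑ i ∈ A, c i • g i) = ∑ i ∈ A, c i • raise v (g i) := by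
  ext s
  simp only [raise, Finset.sum_apply, Pi.smul_apply, smul_eq_mul]
  split_ifs
  · rw [Finset.mul_sum]; exact Finset.sum_congr rfl fun _ _ => by ring
  · simp

/-- The homotopy formula: coning with apex `v` is a contracting homotopy up to the factor `x v`. It
gives both the description of cycles and the factorization `x_v A = C B`. -/
lemma contraction_mulVec_raise (x : Fin n → R) (v : Fin n) (f : Finset (Fin n) → R) :
    (contraction x).mulVec (raise v f) + raise v ((contraction x).mulVec f) = x v • f := by
  rw [contraction_mulVec, contraction_mulVec, raise_sum, ← Finset.sum_add_distrib]
  rw [Finset.sum_eq_single v]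
  · rw [← smul_add, lower_raise_self]
  · intro u _ huv
    rw [← smul_add, lower_raise_of_ne huv, smul_zero]
  · simp

lemma contraction_mulVec_contraction_mulVec (x : Fin n → R) (f : Finset (Fin n) → R) :
    (contraction x).mulVec ((contraction x).mulVec f) = 0 := by
  rw [contraction_mulVec, contraction_mulVec]
  simp only [lower_sum, Finset.smul_sum, smul_smul]
  ext s
  simp only [Finset.sum_apply, Pi.smul_apply, Pi.zero_apply, smul_eq_mul]
  rw [← Finset.sum_product']
  refine Finset.sum_involution (fun p _ => (p.2, p.1)) ?_ ?_ (by simp) (by simp)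
  · rintro ⟨u, v⟩ _
    have := congrFun (lower_lower u v f) s
    simp only [Pi.add_apply, Pi.zero_apply] at this
    linear_combination x u * x v * this
  · rintro ⟨u, v⟩ _ h huv
    simp only [Prod.mk.injEq] at huv
    obtain rfl := huv.1
    apply h
    have : lower v (lower v f) s = 0 := by simp [lower]
    simp [this]

lemma contraction_mul_self (x : Fin n → R) : contraction x * contraction x = 0 := by
  apply Matrix.mulVec_injective
  ext f
  rw [← Matrix.mulVec_mulVec, contraction_mulVec_contraction_mulVec]
  simp

lemma contraction_mul_transpose_add (x : Fin n → R) :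
    contraction x * (contraction x).transpose + (contraction x).transpose * contraction x =
      (∑ v, x v ^ 2) • (1 : Matrix (Finset (Fin n)) (Finset (Fin n)) R) := by
  apply Matrix.mulVec_injective
  ext1 f
  rw [Matrix.add_mulVec, ← Matrix.mulVec_mulVec, ← Matrix.mulVec_mulVec, Matrix.smul_mulVec,
    Matrix.one_mulVec, contraction_transpose_mulVec, contraction_transpose_mulVec,
    Matrix.mulVec_sum, ← Finset.sum_add_distrib, Finset.sum_smul]
  refine Finset.sum_congr rfl fun v _ => ?_
  rw [Matrix.mulVec_smul, ← smul_add, contraction_mulVec_raise, smul_smul, sq]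

/-- The Laplacian of the full simplex is scalar and contraction squares to zero, so the Gram matrix
has no eigenvalues other than `0` and `∑ x_v²`. -/
lemma gram_contraction_mul_self (x : Fin n → R) :
    ((contraction x).transpose * contraction x) * ((contraction x).transpose * contraction x) =
      (∑ v, x v ^ 2) • ((contraction x).transpose * contraction x) := by
  have h := contraction_mul_transpose_add x
  have h2 : contraction x * (contraction x).transpose =
      (∑ v, x v ^ 2) • 1 - (contraction x).transpose * contraction x := eq_sub_of_add_eq h
  calc _ = (contraction x).transpose * ((contraction x * (contraction x).transpose) *
        contraction x) := by simp only [Matrix.mul_assoc]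
    _ = _ := by
      rw [h2, Matrix.sub_mul, Matrix.mul_assoc _ (contraction x) (contraction x),
        contraction_mul_self, Matrix.mul_zero, sub_zero, Matrix.smul_mul, Matrix.one_mul,
        Matrix.mul_smul]

end Koszul

/-! ### The order of the homology group as a reduced determinant. -/

section Homology

variable {n k : ℕ} {T : PreAbstractSimplicialComplex (Fin n)}

/-- The sets of `k` vertices other than `v`. -/
abbrev AvoidingFace (v : Fin n) (k : ℕ) : Type := {s : Finset (Fin n) // s.card = k ∧ v ∉ s}

lemma card_avoidingFace (v : Fin n) (k : ℕ) :
    Fintype.card (AvoidingFace v k) = (n - 1).choose k := by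
  rw [Fintype.card_of_subtype (Finset.powersetCard k (Finset.univ.erase v))]
  · simp
  · intro s
    simp only [Finset.mem_powersetCard, Finset.subset_erase, Finset.subset_univ, true_and]
    tauto

/-- Extension by zero. -/
noncomputable def extendZero {α R : Type*} [Zero R] {p : α → Prop} (f : Subtype p → R) : α → R :=
  Function.extend Subtype.val f 0

lemma extendZero_apply {α R : Type*} [Zero R] {p : α → Prop} (f : Subtype p → R) (a : α)
    (ha : p a) : extendZero f a = f ⟨a, ha⟩ :=
  Subtype.val_injective.extend_apply f 0 ⟨a, ha⟩

lemma extendZero_of_not {α R : Type*} [Zero R] {p : α → Prop} (f : Subtype p → R) (a : α)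
    (ha : ¬ p a) : extendZero f a = 0 :=
  Function.extend_apply' f (0 : α → R) a (by rintro ⟨b, rfl⟩; exact ha b.2)

lemma sum_mul_extendZero {α R : Type*} [CommRing R] [Fintype α] {p : α → Prop}
    [Fintype (Subtype p)] (g : α → R) (f : Subtype p → R) :
    ∑ a, g a * extendZero f a = ∑ b : Subtype p, g b * f b := by
  symm
  refine Fintype.sum_of_injective Subtype.val Subtype.val_injective _ _ ?_ ?_
  · intro a ha
    rw [extendZero_of_not, mul_zero]
    exact fun h => ha ⟨⟨a, h⟩, rfl⟩
  · intro b
    rw [extendZero_apply _ _ b.2]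

lemma contraction_eq_zero {R : Type*} [CommRing R] (x : Fin n → R) {s t : Finset (Fin n)}
    (h : ∀ v ∈ t, s ≠ t.erase v) : contraction x s t = 0 :=
  Finset.sum_eq_zero fun v hv => if_neg (h v hv)

lemma contraction_eq_zero_of_card {R : Type*} [CommRing R] (x : Fin n → R) {s t : Finset (Fin n)}
    (h : s.card + 1 ≠ t.card) : contraction x s t = 0 := by
  refine contraction_eq_zero x fun v hv hs => h ?_
  rw [hs, Finset.card_erase_add_one hv]

lemma contraction_one {R : Type*} [CommRing R] (s t : Finset (Fin n)) :
    contraction (1 : Fin n → R) s t = ((incidence s t : ℤ) : R) := by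
  simp [contraction, incidence, sign]

lemma boundary_apply {R : Type} [CommRing R] (c : ℕ) (f : Face T (c + 1) → R) (s : Face T c) :
    boundary R T c f s = ∑ t : Face T (c + 1), contraction (1 : Fin n → R) s.1 t.1 * f t := by
  simp [boundary, Matrix.mulVec, dotProduct, contraction_one]

/-- Since `T` is closed under nonempty subsets, the contraction of a chain on `T` is again supported
on faces of `T`; identities of the full simplex therefore apply to `T`. -/
lemma contraction_mulVec_extendZero {R : Type} [CommRing R] (c : ℕ) (f : Face T (c + 1) → R) :
    (contraction (1 : Fin n → R)).mulVec (extendZero f) = extendZero (boundary R T c f) := by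
  ext s
  by_cases hs : s.card = c ∧ (s ∈ T.faces ∨ s = ∅)
  · rw [extendZero_apply (boundary R T c f) s hs, boundary_apply]
    exact sum_mul_extendZero _ f
  · rw [extendZero_of_not (boundary R T c f) s hs]
    refine (sum_mul_extendZero _ f).trans (Finset.sum_eq_zero fun t _ => ?_)
    rw [contraction_eq_zero, zero_mul]
    rintro v hv rfl
    refine hs ⟨by rw [Finset.card_erase_of_mem hv, t.2.1]; rfl, ?_⟩
    rcases Finset.eq_empty_or_nonempty (t.1.erase v) with h | h
    · exact Or.inr h
    · rcases t.2.2 with h' | h'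
      · exact Or.inl ((T.isRelLowerSet_faces h').2 (Finset.erase_subset _ _) h)
      · simp [h'] at hv

lemma extendZero_eq_zero {α R : Type*} [Zero R] {p : α → Prop} {f : Subtype p → R} :
    extendZero f = 0 ↔ f = 0 := by
  constructor
  · intro h
    ext a
    rw [← extendZero_apply f a.1 a.2, h]; rfl
  · rintro rfl
    ext a
    by_cases ha : p a
    · rw [extendZero_apply (0 : Subtype p → R) _ ha]; rfl
    · rw [extendZero_of_not (0 : Subtype p → R) _ ha]; rfl

lemma mem_cycles_iff {R : Type} [CommRing R] (c : ℕ) (z : Face T c → R) :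
    z ∈ cycles R T c ↔ (contraction (1 : Fin n → R)).mulVec (extendZero z) = 0 := by
  cases c with
  | zero =>
    simp only [cycles, Submodule.mem_top, true_iff]
    ext s
    refine (sum_mul_extendZero _ z).trans (Finset.sum_eq_zero fun t _ => ?_)
    rw [contraction_eq_zero_of_card, zero_mul]
    rw [t.2.1]; omega
  | succ c =>
    rw [contraction_mulVec_extendZero, extendZero_eq_zero]
    exact LinearMap.mem_ker

lemma range_boundary_le_cycles {R : Type} [CommRing R] (c : ℕ) :
    LinearMap.range (boundary R T c) ≤ cycles R T c := by
  rintro _ ⟨f, rfl⟩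
  rw [mem_cycles_iff, ← contraction_mulVec_extendZero, contraction_mulVec_contraction_mulVec]

lemma IsQAcyclic.face_of_card (hT : IsQAcyclic T k) {s : Finset (Fin n)} (hs : s.card = k) :
    s.card = k ∧ (s ∈ T.faces ∨ s = ∅) := by
  refine ⟨hs, ?_⟩
  rcases Finset.eq_empty_or_nonempty s with h | h
  · exact Or.inr h
  · exact Or.inl (hT.full_skeleton s h hs.le)

/-- The inclusion of the sets of `k` vertices other than `v` in the faces of `T`. -/
def IsQAcyclic.avoidingToFace (hT : IsQAcyclic T k) (v : Fin n) (s : AvoidingFace v k) :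
    Face T k := ⟨s.1, hT.face_of_card s.2.1⟩

/-- If `z` vanishes off `v`, its cone with apex `v` is zero. For a cycle the homotopy formula
recovers `z` as the boundary of that cone. -/
lemma IsQAcyclic.eq_zero_of_mem_cycles (hT : IsQAcyclic T k) (v : Fin n) {R : Type} [CommRing R]
    {z : Face T k → R} (hz : z ∈ cycles R T k)
    (h : ∀ s : AvoidingFace v k, z (hT.avoidingToFace v s) = 0) : z = 0 := by
  rw [mem_cycles_iff] at hz
  have h1 := contraction_mulVec_raise (1 : Fin n → R) v (extendZero z)
  rw [hz] at h1
  have h2 : raise v (extendZero z) = 0 := by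
    ext t
    simp only [raise, Pi.zero_apply]
    split_ifs with ht
    · by_cases h3 : (t.erase v).card = k
      · rw [extendZero_apply z _ (hT.face_of_card h3)]
        have := h ⟨t.erase v, h3, by simp⟩
        simp only [avoidingToFace] at this
        rw [this, mul_zero]
      · rw [extendZero_of_not z _ fun h => h3 h.1, mul_zero]
    · rfl
  have h3 : raise v (0 : Finset (Fin n) → R) = 0 := by ext; simp [raise]
  rw [h2, h3, Matrix.mulVec_zero] at h1
  rw [← extendZero_eq_zero]
  simpa using h1.symm

/-- The boundary of the cone over `g` with apex `v` is a cycle, and by the homotopy formula it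
agrees with `g` on the sets avoiding `v`. -/
lemma IsQAcyclic.exists_mem_cycles (hT : IsQAcyclic T k) (v : Fin n) {R : Type} [CommRing R]
    (g : AvoidingFace v k → R) :
    ∃ z ∈ cycles R T k, ∀ s : AvoidingFace v k, z (hT.avoidingToFace v s) = g s := by
  set w := (contraction (1 : Fin n → R)).mulVec (raise v (extendZero g)) with hw
  have h1 : extendZero (fun s : Face T k => w s.1) = w := by
    ext s
    by_cases hs : s.card = k
    · exact extendZero_apply (fun s : Face T k => w s.1) s (hT.face_of_card hs)
    · rw [extendZero_of_not (fun s : Face T k => w s.1) s fun h => hs h.1, hw]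
      symm
      rw [Matrix.mulVec, dotProduct]
      refine Finset.sum_eq_zero fun t _ => ?_
      by_cases ht : s.card + 1 = t.card
      · simp only [raise]
        split_ifs with hv
        · rw [extendZero_of_not g, mul_zero, mul_zero]
          rintro ⟨h, -⟩
          rw [Finset.card_erase_of_mem hv] at h
          omega
        · rw [mul_zero]
      · rw [contraction_eq_zero_of_card _ ht, zero_mul]
  refine ⟨fun s => w s.1, ?_, fun s => ?_⟩
  · rw [mem_cycles_iff, h1, hw, contraction_mulVec_contraction_mulVec]
  · have h2 := congrFun (contraction_mulVec_raise (1 : Fin n → R) v (extendZero g)) s.1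
    simp only [Pi.add_apply, raise, s.2.2, if_false, add_zero, Pi.one_apply, one_smul] at h2
    rw [extendZero_apply g _ s.2] at h2
    exact h2

/-- The rows of the boundary matrix of `T` that belong to faces without the vertex `v`. -/
def reducedMatrix (R : Type*) [CommRing R] (T : PreAbstractSimplicialComplex (Fin n)) (v : Fin n)
    (k : ℕ) : Matrix (AvoidingFace v k) (Face T (k + 1)) R :=
  (contraction (1 : Fin n → R)).submatrix Subtype.val Subtype.val

lemma IsQAcyclic.boundary_avoidingToFace (hT : IsQAcyclic T k) (v : Fin n) {R : Type} [CommRing R]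
    (f : Face T (k + 1) → R) (s : AvoidingFace v k) :
    boundary R T k f (hT.avoidingToFace v s) = (reducedMatrix R T v k).mulVec f s := by
  rw [boundary_apply]; rfl

lemma IsQAcyclic.boundary_injective (hT : IsQAcyclic T k) {f : Face T (k + 1) → ℚ}
    (hf : boundary ℚ T k f = 0) : f = 0 := by
  have h1 : f ∈ cycles ℚ T (k + 1) := LinearMap.mem_ker.2 hf
  have h2 := hT.homology_eq_zero
  rw [Submodule.Quotient.subsingleton_iff] at h2
  have h3 : (⟨f, h1⟩ : cycles ℚ T (k + 1)) ∈
      (LinearMap.range (boundary ℚ T (k + 1))).submoduleOf (cycles ℚ T (k + 1)) := by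
    rw [h2]; trivial
  obtain ⟨g, hg⟩ := h3
  -- Without faces of dimension `k + 1` there are no boundaries to divide by, so vanishing homology
  -- means vanishing cycles.
  have : IsEmpty (Face T (k + 1 + 1)) := by
    refine ⟨fun s => ?_⟩
    have h4 := s.2.1
    rcases s.2.2 with h | h
    · have := hT.card_le _ h; omega
    · rw [h] at h4; simp at h4
  rw [Subsingleton.elim g 0, map_zero] at hg
  exact hg.symm

lemma IsQAcyclic.det_reducedMatrix_ne_zero (hT : IsQAcyclic T k) (v : Fin n)
    (e : AvoidingFace v k ≃ Face T (k + 1)) :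
    ((reducedMatrix ℤ T v k).submatrix id e).det ≠ 0 := by
  have h1 : ((reducedMatrix ℚ T v k).submatrix id e).det ≠ 0 := by
    intro h
    obtain ⟨g, hg, hg0⟩ := Matrix.exists_mulVec_eq_zero_iff.2 h
    apply hg
    have h2 : (reducedMatrix ℚ T v k).mulVec (g ∘ e.symm) = 0 := by
      rw [← hg0]
      ext s
      simp only [Matrix.mulVec, dotProduct, Matrix.submatrix_apply, id]
      rw [← e.sum_comp]
      simp
    have h3 : boundary ℚ T k (g ∘ e.symm) = 0 := by
      refine hT.eq_zero_of_mem_cycles v (range_boundary_le_cycles k ⟨_, rfl⟩) fun s => ?_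
      rw [hT.boundary_avoidingToFace, h2]; rfl
    have h4 := hT.boundary_injective h3
    ext s
    simpa using congrFun h4 (e s)
  intro h
  apply h1
  have h2 : (reducedMatrix ℚ T v k).submatrix id e =
      ((reducedMatrix ℤ T v k).submatrix id e).map (Int.castRingHom ℚ) := by
    ext s t
    simp [reducedMatrix, contraction_one]
  rw [h2, ← RingHom.mapMatrix_apply, ← RingHom.map_det, h, map_zero]

/-- Restriction identifies the cycles modulo boundaries with a cokernel. -/
lemma IsQAcyclic.nonempty_reducedHomology_equiv (hT : IsQAcyclic T k) (v : Fin n)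
    (e : AvoidingFace v k ≃ Face T (k + 1)) :
    Nonempty (ReducedHomology ℤ T k ≃ₗ[ℤ] (AvoidingFace v k → ℤ) ⧸
      LinearMap.range (((reducedMatrix ℤ T v k).submatrix id e).mulVecLin)) := by
  set N := LinearMap.range (((reducedMatrix ℤ T v k).submatrix id e).mulVecLin) with hN
  let π : cycles ℤ T k →ₗ[ℤ] (AvoidingFace v k → ℤ) :=
    (LinearMap.funLeft ℤ ℤ (hT.avoidingToFace v)).comp (cycles ℤ T k).subtype
  have hπ : ∀ z s, π z s = z.1 (hT.avoidingToFace v s) := fun _ _ => rfl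
  have hmem : ∀ w, w ∈ N ↔ ∃ f, (reducedMatrix ℤ T v k).mulVec f = w := by
    intro w
    constructor
    · rintro ⟨g, rfl⟩
      refine ⟨g ∘ e.symm, ?_⟩
      ext s
      simp only [Matrix.mulVecLin_apply, Matrix.mulVec, dotProduct, Matrix.submatrix_apply, id]
      rw [← e.sum_comp]
      simp
    · rintro ⟨f, rfl⟩
      refine ⟨f ∘ e, ?_⟩
      ext s
      simp only [Matrix.mulVecLin_apply, Matrix.mulVec, dotProduct, Matrix.submatrix_apply, id]
      rw [← e.sum_comp]
      simp
  -- A boundary and a cycle that agree off `v` are equal, so testing membership on the restricted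
  -- rows loses nothing.
  have hker : LinearMap.ker (N.mkQ.comp π) =
      (LinearMap.range (boundary ℤ T k)).submoduleOf (cycles ℤ T k) := by
    ext z
    rw [LinearMap.mem_ker, LinearMap.comp_apply, Submodule.mkQ_apply,
      Submodule.Quotient.mk_eq_zero, hmem, Submodule.submoduleOf, Submodule.mem_comap,
      LinearMap.mem_range]
    refine exists_congr fun f => ⟨fun h => ?_, fun h => ?_⟩
    · rw [← sub_eq_zero]
      refine hT.eq_zero_of_mem_cycles v
        (sub_mem (range_boundary_le_cycles k ⟨f, rfl⟩) z.2) fun s => ?_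
      have := congrFun h s
      rw [hπ] at this
      simp [hT.boundary_avoidingToFace, this]
    · ext s
      rw [hπ, ← hT.boundary_avoidingToFace, h]; rfl
  have hsurj : Function.Surjective (N.mkQ.comp π) := by
    rw [LinearMap.coe_comp]
    refine N.mkQ_surjective.comp fun g => ?_
    obtain ⟨z, hz, hg⟩ := hT.exists_mem_cycles v g
    exact ⟨⟨z, hz⟩, funext hg⟩
  exact ⟨(Submodule.quotEquivOfEq _ _ hker.symm).trans
    ((N.mkQ.comp π).quotKerEquivOfSurjective hsurj)⟩

lemma card_quotient_range_mulVecLin {ι : Type*} [Fintype ι] [DecidableEq ι] (A : Matrix ι ι ℤ)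
    (hA : A.det ≠ 0) :
    Nat.card ((ι → ℤ) ⧸ LinearMap.range A.mulVecLin) = A.det.natAbs := by
  have hinj : Function.Injective A.mulVecLin := by
    rw [← LinearMap.ker_eq_bot, LinearMap.ker_eq_bot']
    intro g hg
    by_contra h
    exact hA (Matrix.exists_mulVec_eq_zero_iff.1 ⟨g, h, hg⟩)
  rw [← Submodule.natAbs_det_equiv _ (LinearEquiv.ofInjective A.mulVecLin hinj)]
  rw [← LinearMap.det_toLin']
  rfl

lemma IsQAcyclic.card_reducedHomology (hT : IsQAcyclic T k) (v : Fin n)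
    (e : AvoidingFace v k ≃ Face T (k + 1)) :
    Nat.card (ReducedHomology ℤ T k) =
      ((reducedMatrix ℤ T v k).submatrix id e).det.natAbs := by
  obtain ⟨f⟩ := hT.nonempty_reducedHomology_equiv v e
  rw [Nat.card_congr f.toEquiv, card_quotient_range_mulVecLin _ (hT.det_reducedMatrix_ne_zero v e)]

lemma mem_kFaces_iff (s : Finset (Fin n)) :
    s ∈ kFaces T k ↔ s.card = k + 1 ∧ (s ∈ T.faces ∨ s = ∅) := by
  constructor
  · exact fun h => ⟨h.2, Or.inl h.1⟩
  · rintro ⟨h, h1 | rfl⟩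
    · exact ⟨h1, h⟩
    · simp at h

lemma IsQAcyclic.card_face (hT : IsQAcyclic T k) :
    Fintype.card (Face T (k + 1)) = m₃ n k := by
  rw [m₃, ← hT.ncard_kFaces, ← Nat.card_coe_set_eq, ← Nat.card_eq_fintype_card]
  exact Nat.card_congr (Equiv.subtypeEquivRight fun s => (mem_kFaces_iff s).symm)

lemma IsQAcyclic.nonempty_equiv (hT : IsQAcyclic T k) (v : Fin n) :
    Nonempty (AvoidingFace v k ≃ Face T (k + 1)) := by
  rw [← Fintype.card_eq, hT.card_face, card_avoidingFace]; rfl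

lemma IsQAcyclic.card_reducedHomology_pos (hT : IsQAcyclic T k) (v : Fin n) :
    0 < Nat.card (ReducedHomology ℤ T k) := by
  obtain ⟨e⟩ := hT.nonempty_equiv v
  rw [hT.card_reducedHomology v e]
  exact Int.natAbs_pos.2 (hT.det_reducedMatrix_ne_zero v e)

end Homology

/-! ### Two determinant computations through eigenvalues. -/

section LinearAlgebra

variable {ι : Type*} [Fintype ι] [DecidableEq ι]

lemma det_le_trace_div_card_pow {A : Matrix ι ι ℝ} (hA : A.PosSemidef) :
    A.det ≤ (A.trace / Fintype.card ι) ^ Fintype.card ι := by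
  rw [hA.isHermitian.det_eq_prod_eigenvalues, hA.isHermitian.trace_eq_sum_eigenvalues]
  simp only [RCLike.ofReal_real_eq_id, id]
  rcases isEmpty_or_nonempty ι with h | h
  · simp
  have hc : (0 : ℝ) < Fintype.card ι := by exact_mod_cast Fintype.card_pos
  have h1 := Real.geom_mean_le_arith_mean Finset.univ (fun _ => (1 : ℝ))
    hA.isHermitian.eigenvalues (by simp) (by simpa using hc) (fun i _ => hA.eigenvalues_nonneg i)
  simp only [Real.rpow_one, one_mul, Finset.sum_const, Finset.card_univ, nsmul_eq_mul,
    mul_one] at h1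
  have h0 : 0 ≤ ∏ i, hA.isHermitian.eigenvalues i :=
    Finset.prod_nonneg fun i _ => hA.eigenvalues_nonneg i
  calc _ = ((∏ i, hA.isHermitian.eigenvalues i) ^ (Fintype.card ι : ℝ)⁻¹) ^ Fintype.card ι := by
        rw [Real.rpow_inv_natCast_pow h0 Fintype.card_ne_zero]
    _ ≤ _ := pow_le_pow_left₀ (Real.rpow_nonneg h0 _) h1 _

/-- `P` is `s` times a projection, so the eigenvalues of the sum are `a` and `a + s`; the trace
fixes their multiplicities as `q` and `p`. -/
lemma det_smul_one_add {P : Matrix ι ι ℝ} (hP : P.transpose = P) {s : ℝ} (hs : 0 < s)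
    (hPP : P * P = s • P) {p q : ℕ} (htr : P.trace = p * s) (hpq : Fintype.card ι = q + p)
    (a : ℝ) : (a • (1 : Matrix ι ι ℝ) + P).det = (a + s) ^ p * a ^ q := by
  set G := a • (1 : Matrix ι ι ℝ) + P with hG
  have hH : G.IsHermitian := by
    rw [Matrix.IsHermitian, Matrix.conjTranspose_eq_transpose_of_trivial, hG,
      Matrix.transpose_add, Matrix.transpose_smul, Matrix.transpose_one, hP]
  have hev : ∀ i, hH.eigenvalues i = a ∨ hH.eigenvalues i = a + s := by
    intro i
    set μ := hH.eigenvalues i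
    have h1 := hH.mulVec_eigenvectorBasis i
    set w : ι → ℝ := ⇑(hH.eigenvectorBasis i) with hw
    have hw0 : w ≠ 0 := by
      intro h
      apply hH.eigenvectorBasis.orthonormal.ne_zero i
      ext j
      exact congrFun h j
    have h2 : P.mulVec w = (μ - a) • w := by
      have : G.mulVec w = a • w + P.mulVec w := by
        rw [hG, Matrix.add_mulVec, Matrix.smul_mulVec, Matrix.one_mulVec]
      rw [sub_smul, ← h1, this]; simp
    -- Evaluating `P²w` in two ways gives `(μ - a)² = s (μ - a)`.
    have h3 : (P * P).mulVec w = (s * (μ - a)) • w := by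
      rw [hPP, Matrix.smul_mulVec, h2, smul_smul]
    rw [← Matrix.mulVec_mulVec, h2, Matrix.mulVec_smul, h2, smul_smul] at h3
    obtain ⟨j, hj⟩ := Function.ne_iff.1 hw0
    have h4 := congrFun h3 j
    simp only [Pi.smul_apply, smul_eq_mul] at h4
    have h5 := mul_right_cancel₀ hj h4
    have h6 : (μ - a) * (μ - (a + s)) = 0 := by linear_combination h5
    rcases mul_eq_zero.1 h6 with h | h
    · left; linarith
    · right; linarith
  have hval : ∀ i, hH.eigenvalues i = if hH.eigenvalues i = a + s then a + s else a := by
    intro i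
    split_ifs with h
    · exact h
    · exact (hev i).resolve_right h
  set c := (Finset.univ.filter fun i => hH.eigenvalues i = a + s).card with hc
  set c' := (Finset.univ.filter fun i => ¬ hH.eigenvalues i = a + s).card with hc'
  have hcc : c + c' = q + p := by
    rw [hc, hc', Finset.card_filter_add_card_filter_not, Finset.card_univ, hpq]
  have htr1 : G.trace = c * (a + s) + c' * a := by
    rw [hH.trace_eq_sum_eigenvalues]
    simp only [RCLike.ofReal_real_eq_id, id]
    rw [Finset.sum_congr rfl fun i _ => hval i, Finset.sum_ite]
    simp [hc, hc']
    ring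
  have htr2 : G.trace = a * (q + p) + p * s := by
    rw [hG, Matrix.trace_add, Matrix.trace_smul, Matrix.trace_one, htr, hpq]
    push_cast; simp
  have hccR : (c : ℝ) + c' = q + p := by exact_mod_cast hcc
  have hcp : c = p := by
    have : ((c : ℝ) - p) * s = 0 := by
      linear_combination htr2 - htr1 - a * hccR
    have := (mul_eq_zero.1 this).resolve_right hs.ne'
    exact_mod_cast sub_eq_zero.1 this
  have hcq : c' = q := by omega
  rw [hH.det_eq_prod_eigenvalues]
  simp only [RCLike.ofReal_real_eq_id, id]
  rw [Finset.prod_congr rfl fun i _ => hval i, Finset.prod_ite, Finset.prod_const,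
    Finset.prod_const, ← hc, ← hc', hcp, hcq]

end LinearAlgebra

/-! ### Counting the faces through a vertex. -/

section Counting

variable {n k : ℕ} {T : PreAbstractSimplicialComplex (Fin n)}

lemma prod_prod_mem {F M : Type*} [Fintype F] [CommMonoid M] (φ : F → Finset (Fin n))
    (x : Fin n → M) :
    ∏ t, ∏ i ∈ φ t, x i = ∏ i, x i ^ (Finset.univ.filter fun t => i ∈ φ t).card := by
  have : ∀ t, ∏ i ∈ φ t, x i = ∏ i, if i ∈ φ t then x i else 1 := by
    intro t; rw [Finset.prod_ite_mem, Finset.univ_inter]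
  simp only [this]
  rw [Finset.prod_comm]
  refine Finset.prod_congr rfl fun i _ => ?_
  rw [Finset.prod_ite]
  simp

lemma sum_sum_mem {F : Type*} [Fintype F] (φ : F → Finset (Fin n)) (x : Fin n → ℝ) :
    ∑ t, ∑ i ∈ φ t, x i = ∑ i, ((Finset.univ.filter fun t => i ∈ φ t).card : ℝ) * x i := by
  have : ∀ t, ∑ i ∈ φ t, x i = ∑ i, if i ∈ φ t then x i else 0 := by
    intro t; rw [Finset.sum_ite_mem, Finset.univ_inter]
  simp only [this]
  rw [Finset.sum_comm]
  refine Finset.sum_congr rfl fun i _ => ?_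
  rw [Finset.sum_ite]
  simp

lemma card_filter_mem_face (i : Fin n) :
    (Finset.univ.filter fun t : Face T (k + 1) => i ∈ t.1).card = degree T k i := by
  rw [degree, ← Set.ncard_coe_finset, ← Set.ncard_image_of_injective _ Subtype.val_injective]
  congr 1
  ext s
  simp only [Set.mem_image, Finset.mem_coe, Finset.mem_filter, Finset.mem_univ, true_and,
    Set.mem_ofPred_eq, mem_kFaces_iff]
  constructor
  · rintro ⟨t, h, rfl⟩
    exact ⟨t.2, h⟩
  · rintro ⟨h, hi⟩
    exact ⟨⟨s, h⟩, hi, rfl⟩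

lemma m₁_add (hn : k + 2 ≤ n) : m₁ n k + (n - 2).choose k = m₃ n k := by
  obtain ⟨m, rfl⟩ : ∃ m, n = m + 2 := ⟨n - 2, by omega⟩
  cases k with
  | zero => simp [m₁, m₃]
  | succ k => simp [m₁, m₃, Nat.choose_succ_succ]

lemma card_filter_mem_avoidingFace (hn : k + 2 ≤ n) {v i : Fin n} (hi : i ≠ v) :
    (Finset.univ.filter fun t : AvoidingFace v k => i ∈ t.1).card = m₁ n k := by
  have h1 := Finset.card_filter_add_card_filter_not (s := Finset.univ)
    (fun t : AvoidingFace v k => i ∈ t.1)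
  rw [Finset.card_univ, card_avoidingFace, ← m₃, ← m₁_add hn] at h1
  have h2 : (Finset.univ.filter fun t : AvoidingFace v k => ¬ i ∈ t.1).card =
      (n - 2).choose k := by
    rw [← Finset.card_image_of_injective _ Subtype.val_injective]
    have : (Finset.univ.filter fun t : AvoidingFace v k => ¬ i ∈ t.1).image Subtype.val =
        Finset.powersetCard k ((Finset.univ.erase v).erase i) := by
      ext s
      simp only [Finset.mem_image, Finset.mem_filter, Finset.mem_univ, true_and, Subtype.exists,
        exists_and_right, exists_eq_right, Finset.mem_powersetCard, Finset.subset_erase,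
        Finset.subset_univ]
      simp only [exists_prop]
      tauto
    rw [this, Finset.card_powersetCard, Finset.card_erase_of_mem (by simp [hi]),
      Finset.card_erase_of_mem (by simp)]
    simp [Nat.sub_sub]
  omega

end Counting

/-! ### Weighted Gram determinants and the bound for every `x`. -/

section Gram

variable {n k : ℕ} {T : PreAbstractSimplicialComplex (Fin n)}

lemma contraction_erase {R : Type*} [CommRing R] (x : Fin n → R) {v : Fin n}
    {t : Finset (Fin n)} (hv : v ∈ t) : contraction x (t.erase v) t = sign R v t * x v := by
  rw [contraction, Matrix.of_apply, Finset.sum_eq_single v]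
  · simp
  · intro u hu huv
    refine if_neg fun h => huv ?_
    by_contra h'
    have : u ∈ t.erase v := Finset.mem_erase.2 ⟨h', hu⟩
    rw [h] at this
    simp at this
  · exact fun h => absurd hv h

lemma exists_of_contraction_ne_zero {R : Type*} [CommRing R] {x : Fin n → R}
    {s t : Finset (Fin n)} (h : contraction x s t ≠ 0) : ∃ v ∈ t, s = t.erase v ∧ x v ≠ 0 := by
  obtain ⟨v, hv, h1⟩ := Finset.exists_ne_zero_of_sum_ne_zero h
  refine ⟨v, hv, ?_, ?_⟩
  · by_contra h2; exact h1 (if_neg h2)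
  · intro h2; apply h1; simp [h2]

lemma prod_mul_contraction {R : Type*} [CommRing R] (x : Fin n → R) (s t : Finset (Fin n)) :
    (∏ i ∈ s, x i) * contraction x s t = (∏ i ∈ t, x i) * contraction (1 : Fin n → R) s t := by
  simp only [contraction, Matrix.of_apply, Finset.mul_sum, Pi.one_apply, mul_one]
  refine Finset.sum_congr rfl fun v hv => ?_
  split_ifs with h
  · rw [h, ← Finset.prod_erase_mul t x hv]; ring
  · simp

lemma gram_contraction_diag (x : Fin n → ℝ) (t : Finset (Fin n)) :
    ∑ s, contraction x s t * contraction x s t = ∑ i ∈ t, x i ^ 2 := by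
  have h := congrFun (contraction_transpose_mulVec x (fun s => contraction x s t)) t
  simp only [Matrix.mulVec, dotProduct, Matrix.transpose_apply] at h
  rw [h]
  simp only [Finset.sum_apply, Pi.smul_apply, raise, smul_eq_mul, mul_ite, mul_zero,
    Finset.sum_ite_mem, Finset.univ_inter]
  refine Finset.sum_congr rfl fun v hv => ?_
  rw [contraction_erase x hv]
  linear_combination x v ^ 2 * sign_mul_self (R := ℝ) v t

lemma sign_of_forall_le {R : Type*} [CommRing R] {v : Fin n} (hv : ∀ u, v ≤ u)
    (s : Finset (Fin n)) : sign R v s = 1 := by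
  rw [sign, Finset.filter_false_of_mem fun u _ => (hv u).not_gt]
  simp

/-- The homotopy formula applied to the boundary of `t`, which is itself a cycle. As `v` is the
least vertex, coning introduces no sign. This is the entrywise form of `x_v A = C B`. -/
lemma smul_contraction {R : Type*} [CommRing R] (x : Fin n → R) {v : Fin n} (hv : ∀ u, v ≤ u)
    (s : Finset (Fin n)) {t : Finset (Fin n)} (ht : t.card = k + 1) :
    x v * contraction x s t =
      ∑ r : AvoidingFace v k, contraction x s (insert v r.1) * contraction x r.1 t := by
  have h := contraction_mulVec_raise x v ((contraction x).mulVec (Pi.single t 1))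
  rw [contraction_mulVec_contraction_mulVec] at h
  have h1 := congrFun h s
  simp only [Pi.add_apply, raise, Pi.zero_apply, mul_zero, ite_self, add_zero, Pi.smul_apply,
    smul_eq_mul, Matrix.mulVec_single_one, Matrix.col_apply] at h1
  rw [← h1]
  symm
  refine Fintype.sum_of_injective (fun r : AvoidingFace v k => insert v r.1) ?_ _ _ ?_ ?_
  · intro r r' h
    apply Subtype.ext
    have := congrArg (fun s => s.erase v) h
    simpa [r.2.2, r'.2.2] using this
  · intro r hr
    simp only [raise]
    split_ifs with hvr
    · rw [Matrix.col_apply, contraction_eq_zero_of_card x (s := r.erase v), mul_zero, mul_zero]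
      intro h
      refine hr ⟨⟨r.erase v, by omega, by simp⟩, ?_⟩
      simp [hvr]
    · rw [mul_zero]
  · intro r
    simp [raise, sign_of_forall_le hv, r.2.2]

lemma contraction_insert_right {R : Type*} [CommRing R] (x : Fin n → R) {v : Fin n}
    (hv : ∀ u, v ≤ u) (s : Finset (Fin n)) {t : Finset (Fin n)} (ht : v ∉ t) :
    contraction x s (insert v t) =
      if v ∈ s then - contraction x (s.erase v) t else if s = t then x v else 0 := by
  have h0 : raise v (Pi.single t (1 : R)) = Pi.single (insert v t) 1 := by
    ext s
    simp only [raise, sign_of_forall_le hv, one_mul, Pi.single_apply]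
    by_cases hs : v ∈ s
    · have : s.erase v = t ↔ s = insert v t := by
        constructor
        · rintro rfl; exact (Finset.insert_erase hs).symm
        · rintro rfl; exact Finset.erase_insert ht
      simp [hs, this]
    · have : s ≠ insert v t := by rintro rfl; simp at hs
      simp [hs, this]
  have h := congrFun (contraction_mulVec_raise x v (Pi.single t 1)) s
  rw [h0] at h
  simp only [Pi.add_apply, raise, Pi.smul_apply, smul_eq_mul, Matrix.mulVec_single_one,
    Matrix.col_apply, sign_of_forall_le hv, one_mul, Pi.single_apply] at h
  split_ifs with h1 h2
  · have : s ≠ t := by rintro rfl; exact ht h1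
    simp only [h1, this, if_true, if_false, mul_zero] at h
    exact eq_neg_of_add_eq_zero_left h
  · subst h2
    simpa [ht] using h
  · simpa [h1, h2] using h

lemma contraction_update (x : Fin n → ℝ) (v : Fin n) (s : Finset (Fin n)) {t : Finset (Fin n)}
    (ht : v ∉ t) : contraction (Function.update x v 0) s t = contraction x s t := by
  refine Finset.sum_congr rfl fun u hu => ?_
  rw [Function.update_of_ne]
  rintro rfl; exact ht hu

/-- The Gram matrix of contraction on the sets of `k` vertices other than `v`. -/
def linkGram (x : Fin n → ℝ) (v : Fin n) (k : ℕ) :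
    Matrix (AvoidingFace v k) (AvoidingFace v k) ℝ :=
  ((contraction (Function.update x v 0)).transpose *
    contraction (Function.update x v 0)).submatrix Subtype.val Subtype.val

/-- The boundary of a cone consists of its base, weighted by `x v`, and of minus the cone over the
boundary of the base. The former avoids `v` and the latter contains it, so there are no cross terms.
-/
lemma gram_cone (x : Fin n → ℝ) {v : Fin n} (hv : ∀ u, v ≤ u) :
    (Matrix.of fun (s : Finset (Fin n)) (t : AvoidingFace v k) =>
      contraction x s (insert v t.1)).transpose *
    (Matrix.of fun (s : Finset (Fin n)) (t : AvoidingFace v k) =>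
      contraction x s (insert v t.1)) = (x v ^ 2) • 1 + linkGram x v k := by
  ext t t'
  simp only [Matrix.mul_apply, Matrix.transpose_apply, Matrix.of_apply, Matrix.add_apply,
    Matrix.smul_apply, linkGram, Matrix.submatrix_apply, smul_eq_mul,
    contraction_update x v _ t.2.2, contraction_update x v _ t'.2.2,
    contraction_insert_right x hv _ t.2.2, contraction_insert_right x hv _ t'.2.2]
  have h1 : ∀ s : Finset (Fin n),
      (if v ∈ s then -contraction x (s.erase v) t.1 else if s = t.1 then x v else 0) *
      (if v ∈ s then -contraction x (s.erase v) t'.1 else if s = t'.1 then x v else 0) =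
      (if v ∈ s then contraction x (s.erase v) t.1 * contraction x (s.erase v) t'.1 else 0) +
      (if s = t.1 then (if t.1 = t'.1 then x v ^ 2 else 0) else 0) := by
    intro s
    by_cases hs : v ∈ s
    · have : s ≠ t.1 := by rintro rfl; exact t.2.2 hs
      simp [hs, this]
    · by_cases h : s = t.1
      · subst h
        simp [hs, sq]
      · simp [hs, h]
  rw [Finset.sum_congr rfl fun s _ => h1 s, Finset.sum_add_distrib, add_comm]
  congr 1
  · simp [Matrix.one_apply, Subtype.ext_iff]
  · rw [← Finset.sum_filter]
    have h2 : ∀ s : Finset (Fin n), v ∈ s → contraction x s t.1 = 0 := by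
      intro s hs
      apply contraction_eq_zero
      rintro u hu rfl
      exact t.2.2 (Finset.mem_of_mem_erase hs)
    rw [← Finset.sum_filter_add_sum_filter_not Finset.univ (fun s : Finset (Fin n) => v ∈ s)
      (fun s => contraction x s t.1 * contraction x s t'.1)]
    rw [Finset.sum_eq_zero (s := Finset.univ.filter fun s : Finset (Fin n) => v ∈ s)
      (f := fun s => contraction x s t.1 * contraction x s t'.1)
      (fun s hs => by rw [h2 s (by simpa using hs), zero_mul]), zero_add]
    refine Finset.sum_nbij' (fun s => s.erase v) (fun s => insert v s) ?_ ?_ ?_ ?_ ?_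
    · simp
    · simp
    · intro s hs; exact Finset.insert_erase (by simpa using hs)
    · intro s hs; exact Finset.erase_insert (by simpa using hs)
    · simp

lemma linkGram_transpose (x : Fin n → ℝ) (v : Fin n) :
    (linkGram x v k).transpose = linkGram x v k := by
  rw [linkGram, Matrix.transpose_submatrix, Matrix.transpose_mul, Matrix.transpose_transpose]

/-- The identity for the full Gram matrix passes to the block: contraction followed by its transpose
preserves cardinality, and with the weight of `v` set to zero it never introduces `v`. -/
lemma linkGram_mul_self (x : Fin n → ℝ) (v : Fin n) :
    linkGram x v k * linkGram x v k =
      (∑ i, Function.update x v 0 i ^ 2) • linkGram x v k := by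
  ext t t'
  have h := congrFun (congrFun (gram_contraction_mul_self (Function.update x v 0)) t.1) t'.1
  simp only [Matrix.smul_apply] at h ⊢
  rw [linkGram, Matrix.submatrix_apply, ← h, Matrix.mul_apply, Matrix.mul_apply]
  refine Fintype.sum_of_injective Subtype.val Subtype.val_injective _ _ ?_ ?_
  · intro r hr
    rw [Matrix.mul_apply, Finset.sum_eq_zero, zero_mul]
    intro s _
    rw [Matrix.transpose_apply]
    by_contra h0
    obtain ⟨u, hu, rfl, -⟩ := exists_of_contraction_ne_zero (left_ne_zero_of_mul h0)
    obtain ⟨w, hw, hs, hx⟩ := exists_of_contraction_ne_zero (right_ne_zero_of_mul h0)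
    refine hr ⟨⟨r, ?_, ?_⟩, rfl⟩
    · rw [← t.2.1, ← Finset.card_erase_add_one hw, ← hs, Finset.card_erase_add_one hu]
    · intro hvr
      have hvw : v ≠ w := by rintro rfl; simp at hx
      have : v ∈ r.erase w := Finset.mem_erase.2 ⟨hvw, hvr⟩
      rw [← hs] at this
      exact t.2.2 (Finset.mem_of_mem_erase this)
  · intro r; rfl

lemma linkGram_trace (hn : k + 2 ≤ n) (x : Fin n → ℝ) (v : Fin n) :
    (linkGram x v k).trace = m₁ n k * ∑ i, Function.update x v 0 i ^ 2 := by
  have h1 : (linkGram x v k).trace =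
      ∑ t : AvoidingFace v k, ∑ i ∈ t.1, Function.update x v 0 i ^ 2 := by
    rw [Matrix.trace]
    refine Finset.sum_congr rfl fun t _ => ?_
    rw [← gram_contraction_diag]
    simp [linkGram, Matrix.mul_apply]
  rw [h1, sum_sum_mem, Finset.mul_sum]
  refine Finset.sum_congr rfl fun i _ => ?_
  rcases eq_or_ne i v with rfl | hi
  · simp
  · rw [card_filter_mem_avoidingFace hn hi]

lemma sum_update_sq (x : Fin n → ℝ) (v : Fin n) :
    x v ^ 2 + ∑ i, Function.update x v 0 i ^ 2 = ∑ i, x i ^ 2 := by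
  rw [← Finset.add_sum_erase _ _ (Finset.mem_univ v),
    ← Finset.add_sum_erase _ (fun i => x i ^ 2) (Finset.mem_univ v)]
  simp only [Function.update_self, ne_eq, OfNat.ofNat_ne_zero, not_false_eq_true, zero_pow,
    zero_add]
  congr 1
  refine Finset.sum_congr rfl fun i hi => ?_
  rw [Function.update_of_ne (Finset.ne_of_mem_erase hi)]

lemma det_gram_cone (hn : k + 2 ≤ n) (x : Fin n → ℝ) (hx : ∀ i, x i ≠ 0) (v : Fin n) :
    ((x v ^ 2) • 1 + linkGram x v k).det =
      (∑ i, x i ^ 2) ^ m₁ n k * (x v ^ 2) ^ (n - 2).choose k := by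
  rw [← sum_update_sq x v]
  refine det_smul_one_add (linkGram_transpose x v) ?_ (linkGram_mul_self x v)
    (linkGram_trace hn x v) ?_ _
  · obtain ⟨u, hu⟩ : ∃ u : Fin n, u ≠ v := by
      have : Nontrivial (Fin n) := Fin.nontrivial_iff_two_le.2 (by omega)
      exact exists_ne v
    refine Finset.sum_pos' (fun i _ => sq_nonneg _) ⟨u, Finset.mem_univ _, ?_⟩
    rw [Function.update_of_ne hu]
    exact sq_pos_of_ne_zero (hx u)
  · rw [card_avoidingFace, ← m₃, ← m₁_add hn, add_comm]

/-- The bound by `f` with denominators cleared, so that it is available before `m₁ ≤ d_i` is known.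
The only inequality used is AM-GM for the eigenvalues of `AᵀA`. -/
lemma IsQAcyclic.sq_card_reducedHomology_mul_le (hT : IsQAcyclic T k) (hn : k + 2 ≤ n)
    (x : Fin n → ℝ) (hx : ∀ i, x i ≠ 0) :
    (Nat.card (ReducedHomology ℤ T k) : ℝ) ^ 2 * (∏ i, (x i ^ 2) ^ degree T k i) *
        (∑ i, x i ^ 2) ^ m₁ n k ≤
      (∏ i, (x i ^ 2) ^ m₁ n k) * ((∑ i, (degree T k i : ℝ) * x i ^ 2) / m₃ n k) ^ m₃ n k := by
  obtain ⟨v, hv⟩ : ∃ v : Fin n, ∀ u, v ≤ u := ⟨⟨0, by omega⟩, fun u => Nat.zero_le _⟩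
  obtain ⟨e⟩ := hT.nonempty_equiv v
  set D := ((reducedMatrix ℤ T v k).submatrix id e).det with hD
  set A : Matrix (Finset (Fin n)) (AvoidingFace v k) ℝ :=
    Matrix.of fun s t => contraction x s (e t).1 with hA
  set C : Matrix (Finset (Fin n)) (AvoidingFace v k) ℝ :=
    Matrix.of fun s t => contraction x s (insert v t.1) with hC
  set B : Matrix (AvoidingFace v k) (AvoidingFace v k) ℝ :=
    Matrix.of fun s t => contraction x s.1 (e t).1 with hB
  have hcard : Fintype.card (AvoidingFace v k) = m₃ n k := card_avoidingFace v k
  have hfac : x v • A = C * B := by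
    ext s t
    simp only [hA, hB, hC, Matrix.smul_apply, Matrix.mul_apply, Matrix.of_apply, smul_eq_mul]
    exact smul_contraction x hv s (e t).2.1
  have hdet : (x v ^ 2) ^ m₃ n k * (A.transpose * A).det =
      (∑ i, x i ^ 2) ^ m₁ n k * (x v ^ 2) ^ (n - 2).choose k * B.det ^ 2 := by
    have h1 : (x v ^ 2) • (A.transpose * A) = B.transpose * (C.transpose * C) * B := by
      rw [Matrix.mul_assoc, Matrix.mul_assoc, ← Matrix.mul_assoc, ← Matrix.transpose_mul, ← hfac,
        Matrix.transpose_smul, Matrix.smul_mul, Matrix.mul_smul, smul_smul, sq]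
    rw [← hcard, ← Matrix.det_smul, h1, Matrix.det_mul, Matrix.det_mul, Matrix.det_transpose,
      gram_cone x hv, det_gram_cone hn x hx]
    ring
  -- Conjugating by products of the `x_i` over faces turns weighted incidence numbers into
  -- unweighted ones.
  have hBD : (∏ t : AvoidingFace v k, ∏ i ∈ t.1, x i) * B.det =
      (∏ t : Face T (k + 1), ∏ i ∈ t.1, x i) * D := by
    have h1 : Matrix.diagonal (fun t : AvoidingFace v k => ∏ i ∈ t.1, x i) * B =
        ((reducedMatrix ℤ T v k).submatrix id e).map (Int.castRingHom ℝ) *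
          Matrix.diagonal (fun t : AvoidingFace v k => ∏ i ∈ (e t).1, x i) := by
      ext s t
      rw [Matrix.diagonal_mul, Matrix.mul_diagonal]
      simp only [hB, Matrix.of_apply, Matrix.map_apply, Matrix.submatrix_apply, reducedMatrix, id]
      rw [prod_mul_contraction, mul_comm, contraction_one, contraction_one]
      simp
    have h2 := congrArg Matrix.det h1
    rw [Matrix.det_mul, Matrix.det_mul, Matrix.det_diagonal, Matrix.det_diagonal,
      ← RingHom.mapMatrix_apply, ← RingHom.map_det] at h2
    rw [h2, e.prod_comp (fun t : Face T (k + 1) => ∏ i ∈ t.1, x i), mul_comm]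
    rfl
  have hle : (A.transpose * A).det ≤
      ((∑ i, (degree T k i : ℝ) * x i ^ 2) / m₃ n k) ^ m₃ n k := by
    have h1 : (A.transpose * A).PosSemidef := by
      have := Matrix.posSemidef_conjTranspose_mul_self A
      rwa [Matrix.conjTranspose_eq_transpose_of_trivial] at this
    have h2 : (A.transpose * A).trace = ∑ i, (degree T k i : ℝ) * x i ^ 2 := by
      have h3 : (A.transpose * A).trace = ∑ t, ∑ i ∈ (e t).1, x i ^ 2 := by
        refine Finset.sum_congr rfl fun t _ => ?_
        rw [← gram_contraction_diag]
        simp [hA, Matrix.mul_apply]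
      rw [h3, e.sum_comp (fun t : Face T (k + 1) => ∑ i ∈ t.1, x i ^ 2), sum_sum_mem]
      simp only [card_filter_mem_face]
    have := det_le_trace_div_card_pow h1
    rwa [h2, hcard] at this
  have hP1 : (∏ t : Face T (k + 1), ∏ i ∈ t.1, x i) ^ 2 = ∏ i, (x i ^ 2) ^ degree T k i := by
    rw [prod_prod_mem, ← Finset.prod_pow]
    refine Finset.prod_congr rfl fun i _ => ?_
    rw [card_filter_mem_face, ← pow_mul, ← pow_mul, mul_comm]
  -- The vertex `v` lies in no avoiding set; its missing factor is what remains of the powers of `x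
  -- v` in `hdet`.
  have hP2 : (x v ^ 2) ^ m₁ n k * (∏ t : AvoidingFace v k, ∏ i ∈ t.1, x i) ^ 2 =
      ∏ i, (x i ^ 2) ^ m₁ n k := by
    rw [prod_prod_mem, ← Finset.prod_pow, ← Finset.mul_prod_erase _ _ (Finset.mem_univ v),
      ← Finset.mul_prod_erase _ (fun i => (x i ^ 2) ^ m₁ n k) (Finset.mem_univ v)]
    congr 1
    have h1 : (Finset.univ.filter fun t : AvoidingFace v k => v ∈ t.1).card = 0 := by
      rw [Finset.card_eq_zero]
      exact Finset.filter_false_of_mem fun t _ => t.2.2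
    rw [h1, pow_zero, one_pow, one_mul]
    refine Finset.prod_congr rfl fun i hi => ?_
    rw [card_filter_mem_avoidingFace hn (Finset.ne_of_mem_erase hi), ← pow_mul, ← pow_mul,
      mul_comm]
  have hD2 : (Nat.card (ReducedHomology ℤ T k) : ℝ) ^ 2 = (D : ℝ) ^ 2 := by
    rw [hT.card_reducedHomology v e, ← hD, Nat.cast_natAbs, Int.cast_abs, sq_abs]
  have hxv : 0 < x v ^ 2 := sq_pos_of_ne_zero (hx v)
  rw [hD2, ← hP1, ← hP2]
  have h1 : (D : ℝ) ^ 2 * (∏ t : Face T (k + 1), ∏ i ∈ t.1, x i) ^ 2 =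
      (∏ t : AvoidingFace v k, ∏ i ∈ t.1, x i) ^ 2 * B.det ^ 2 := by
    rw [← mul_pow, ← mul_pow, hBD]; ring
  rw [h1]
  -- Of the exponent `m₃ = m₁ + (n - 2).choose k`, the second summand cancels.
  have h2 : (∑ i, x i ^ 2) ^ m₁ n k * B.det ^ 2 =
      (x v ^ 2) ^ m₁ n k * (A.transpose * A).det := by
    rw [← m₁_add hn, pow_add] at hdet
    have : (x v ^ 2) ^ (n - 2).choose k ≠ 0 := (pow_pos hxv _).ne'
    apply mul_left_cancel₀ this
    linear_combination -hdet
  calc _ = (∏ t : AvoidingFace v k, ∏ i ∈ t.1, x i) ^ 2 *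
        ((∑ i, x i ^ 2) ^ m₁ n k * B.det ^ 2) := by ring
    _ = (x v ^ 2) ^ m₁ n k * (∏ t : AvoidingFace v k, ∏ i ∈ t.1, x i) ^ 2 *
        (A.transpose * A).det := by rw [h2]; ring
    _ ≤ _ := mul_le_mul_of_nonneg_left hle (by positivity)

lemma IsQAcyclic.sum_degree (hT : IsQAcyclic T k) :
    ∑ i, degree T k i = (k + 1) * m₃ n k := by
  have h := sum_sum_mem (fun t : Face T (k + 1) => t.1) (fun _ => (1 : ℝ))
  have h1 : ∀ t : Face T (k + 1), ∑ i ∈ t.1, (1 : ℝ) = k + 1 := by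
    intro t; rw [Finset.sum_const, t.2.1]; simp
  simp only [h1, card_filter_mem_face, mul_one, Finset.sum_const, Finset.card_univ,
    hT.card_face, nsmul_eq_mul] at h
  have : ((∑ i, degree T k i : ℕ) : ℝ) = (k + 1) * m₃ n k := by push_cast; rw [← h]; ring
  exact_mod_cast this

lemma IsQAcyclic.degree_le (hT : IsQAcyclic T k) (i : Fin n) : degree T k i ≤ m₃ n k := by
  rw [← hT.card_face, ← card_filter_mem_face]
  exact Finset.card_filter_le _ _

end Gram

/-! ### The equation for `α` and the minimum of the relaxed bound. -/

section Optimization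

variable {n k : ℕ} {d : Fin n → ℕ} {α : ℝ}

lemma mul_m₃ (hn : k + 2 ≤ n) : (k : ℝ) * m₃ n k = ((n : ℝ) - 1) * m₁ n k := by
  obtain ⟨m, rfl⟩ : ∃ m, n = m + 2 := ⟨n - 2, by omega⟩
  cases k with
  | zero => simp [m₁]
  | succ k =>
    have h := Nat.add_one_mul_choose_eq m k
    have h' : ((m : ℝ) + 1) * m.choose k = (m + 1).choose (k + 1) * (k + 1) := by exact_mod_cast h
    simp only [m₁, m₃, Nat.add_sub_cancel, show m + 2 - 1 = m + 1 from rfl]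
    push_cast
    linear_combination -h'

lemma choose_sub_two_pos (hn : k + 2 ≤ n) : 0 < (n - 2).choose k :=
  Nat.choose_pos (by omega)

lemma m₃_pos (hn : k + 2 ≤ n) : 0 < m₃ n k := Nat.choose_pos (by omega)

lemma sum_sub_m₁ (hn : k + 2 ≤ n) (hsum : ∑ i, d i = (k + 1) * m₃ n k) :
    ∑ i, ((d i : ℝ) - m₁ n k) = ((n - 2).choose k : ℕ) := by
  have h1 : (∑ i, (d i : ℝ)) = (k + 1) * m₃ n k := by exact_mod_cast hsum
  have h2 : (m₁ n k : ℝ) + ((n - 2).choose k : ℕ) = m₃ n k := by exact_mod_cast m₁_add hn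
  rw [Finset.sum_sub_distrib, h1]
  simp only [Finset.sum_const, Finset.card_univ, Fintype.card_fin, nsmul_eq_mul]
  linear_combination mul_m₃ hn - h2

lemma exists_m₁_lt (hn : k + 2 ≤ n) (hsum : ∑ i, d i = (k + 1) * m₃ n k) :
    ∃ i, m₁ n k < d i := by
  by_contra! h
  have h1 : ∑ i, ((d i : ℝ) - m₁ n k) ≤ 0 :=
    Finset.sum_nonpos fun i _ => sub_nonpos.2 (by exact_mod_cast h i)
  rw [sum_sub_m₁ hn hsum] at h1
  have : (0 : ℝ) < ((n - 2).choose k : ℕ) := by exact_mod_cast choose_sub_two_pos hn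
  linarith

lemma sub_m₁_mul_pos (hα : α ≤ 1) {i : Fin n} (hi : m₁ n k < d i) :
    0 < (d i : ℝ) - m₁ n k * α := by
  have h1 : (m₁ n k : ℝ) < d i := by exact_mod_cast hi
  have h2 : (0 : ℝ) ≤ m₁ n k := Nat.cast_nonneg _
  nlinarith

/-- After multiplication by `α` the equation has constant right-hand side 1, and each nonzero term
on the left is strictly increasing; this gives uniqueness. -/
lemma mul_sum_lt_mul_sum (hge : ∀ i, m₁ n k ≤ d i) (hex : ∃ i, m₁ n k < d i) {β : ℝ}
    (hαβ : α < β) (hβ : β ≤ 1) :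
    α * ∑ i, ((d i : ℝ) - m₁ n k) / ((d i : ℝ) - m₁ n k * α) <
      β * ∑ i, ((d i : ℝ) - m₁ n k) / ((d i : ℝ) - m₁ n k * β) := by
  have key : ∀ i, m₁ n k < d i → α * (((d i : ℝ) - m₁ n k) / ((d i : ℝ) - m₁ n k * α)) <
      β * (((d i : ℝ) - m₁ n k) / ((d i : ℝ) - m₁ n k * β)) := by
    intro i hi
    have h1 : (m₁ n k : ℝ) < d i := by exact_mod_cast hi
    have h2 : (0 : ℝ) ≤ m₁ n k := Nat.cast_nonneg _
    rw [← mul_div_assoc, ← mul_div_assoc, div_lt_div_iff₀ (sub_m₁_mul_pos (by linarith) hi)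
      (sub_m₁_mul_pos hβ hi)]
    have h3 : 0 < ((d i : ℝ) - m₁ n k) * d i * (β - α) :=
      mul_pos (mul_pos (by linarith) (by linarith)) (by linarith)
    linarith
  rw [Finset.mul_sum, Finset.mul_sum]
  obtain ⟨i, hi⟩ := hex
  refine Finset.sum_lt_sum (fun j _ => ?_) ⟨i, Finset.mem_univ _, key i hi⟩
  rcases (hge j).lt_or_eq with h | h
  · exact (key j h).le
  · rw [← h]; simp

lemma SolvesAlpha.unique (hge : ∀ i, m₁ n k ≤ d i) (hex : ∃ i, m₁ n k < d i) {β : ℝ}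
    (hα0 : 0 < α) (hα1 : α ≤ 1) (hβ0 : 0 < β) (hβ1 : β ≤ 1) (hα : SolvesAlpha k d α)
    (hβ : SolvesAlpha k d β) : β = α := by
  unfold SolvesAlpha at hα hβ
  rcases lt_trichotomy α β with h | h | h
  · have := mul_sum_lt_mul_sum hge hex h hβ1
    rw [hα, hβ, mul_inv_cancel₀ hα0.ne', mul_inv_cancel₀ hβ0.ne'] at this
    exact absurd this (lt_irrefl _)
  · exact h.symm
  · have := mul_sum_lt_mul_sum hge hex h hα1
    rw [hα, hβ, mul_inv_cancel₀ hα0.ne', mul_inv_cancel₀ hβ0.ne'] at this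
    exact absurd this (lt_irrefl _)

lemma exists_solvesAlpha (hn : k + 2 ≤ n) (hsum : ∑ i, d i = (k + 1) * m₃ n k)
    (hge : ∀ i, m₁ n k ≤ d i) {a b : ℝ} (ha : 0 < a) (hab : a ≤ b) (hb : b ≤ 1)
    (ha' : ∀ i, m₁ n k < d i → a ≤ d i / m₃ n k) (hb' : ∀ i, (d i : ℝ) / m₃ n k ≤ b) :
    ∃ α ∈ Set.Icc a b, SolvesAlpha k d α := by
  have hm2 : (0 : ℝ) < ((n - 2).choose k : ℕ) := by exact_mod_cast choose_sub_two_pos hn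
  have hm3 : (0 : ℝ) < m₃ n k := by exact_mod_cast m₃_pos hn
  have h23 : (m₁ n k : ℝ) + ((n - 2).choose k : ℕ) = m₃ n k := by exact_mod_cast m₁_add hn
  have hp : ∀ i, 0 ≤ (d i : ℝ) - m₁ n k := fun i => sub_nonneg.2 (by exact_mod_cast hge i)
  have h1 : ∑ i, ((d i : ℝ) - m₁ n k) / ((n - 2).choose k : ℕ) = 1 := by
    rw [← Finset.sum_div, sum_sub_m₁ hn hsum, div_self hm2.ne']
  set g : ℝ → ℝ := fun x => ∑ i, x * (((d i : ℝ) - m₁ n k) / ((d i : ℝ) - m₁ n k * x)) with hg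
  have hcont : ContinuousOn g (Set.Icc a b) := by
    refine continuousOn_finsetSum _ fun i _ => ?_
    rcases (hge i).lt_or_eq with h | h
    · refine continuousOn_id.mul (continuousOn_const.div (by fun_prop) fun x hx => ?_)
      exact (sub_m₁_mul_pos (hx.2.trans hb) h).ne'
    · rw [← h]; simp [continuousOn_const]
  -- With `m₂ = (n - 2).choose k`, the constant 1 is split as `∑ (d_i - m₁)/m₂`. The comparison of
  -- terms with `d_i > m₁` reduces to `a m₃ ≤ d_i`; at `b` the inequality is reversed.
  have hga : g a ≤ 1 := by
    rw [hg, ← h1]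
    refine Finset.sum_le_sum fun i _ => ?_
    rcases (hge i).lt_or_eq with h | h
    · rw [← mul_div_assoc, div_le_div_iff₀ (sub_m₁_mul_pos (hab.trans hb) h) hm2, mul_comm a,
        mul_assoc]
      refine mul_le_mul_of_nonneg_left ?_ (hp i)
      have := (le_div_iff₀ hm3).1 (ha' i h)
      rw [← h23] at this
      linarith
    · rw [← h]; simp
  have hgb : 1 ≤ g b := by
    rw [hg, ← h1]
    refine Finset.sum_le_sum fun i _ => ?_
    rcases (hge i).lt_or_eq with h | h
    · rw [← mul_div_assoc, div_le_div_iff₀ hm2 (sub_m₁_mul_pos hb h), mul_comm b, mul_assoc]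
      refine mul_le_mul_of_nonneg_left ?_ (hp i)
      have := (div_le_iff₀ hm3).1 (hb' i)
      rw [← h23] at this
      linarith
    · rw [← h]; simp
  obtain ⟨α, hα, hα1⟩ := intermediate_value_Icc hab hcont ⟨hga, hgb⟩
  refine ⟨α, hα, ?_⟩
  have hα0 : α ≠ 0 := (ha.trans_le hα.1).ne'
  rw [hg] at hα1
  simp only [← Finset.mul_sum] at hα1
  exact eq_inv_of_mul_eq_one_right hα1

lemma prod_pow_le_div_pow {ι : Type*} [Fintype ι] (w : ι → ℕ) (z : ι → ℝ) (hz : ∀ i, 0 ≤ z i)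
    (hw : 0 < ∑ i, w i) :
    ∏ i, z i ^ w i ≤ ((∑ i, (w i : ℝ) * z i) / (∑ i, w i : ℕ)) ^ (∑ i, w i) := by
  have hw' : (0 : ℝ) < ∑ i, (w i : ℝ) := by exact_mod_cast hw
  have h1 := Real.geom_mean_le_arith_mean Finset.univ (fun i => (w i : ℝ)) z
    (by simp) hw' (fun i _ => hz i)
  simp only [Real.rpow_natCast] at h1
  have h0 : 0 ≤ ∏ i, z i ^ w i := Finset.prod_nonneg fun i _ => pow_nonneg (hz i) _
  calc _ = ((∏ i, z i ^ w i) ^ (((∑ i, w i : ℕ) : ℝ))⁻¹) ^ (∑ i, w i) := by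
        rw [Real.rpow_inv_natCast_pow h0 hw.ne']
    _ ≤ _ := by
      push_cast
      exact pow_le_pow_left₀ (Real.rpow_nonneg h0 _) h1 _

/-- The squares of the coordinates of a minimizer of `relaxedBound`. -/
noncomputable def minimizerSq (k : ℕ) (d : Fin n → ℕ) (α : ℝ) (i : Fin n) : ℝ :=
  ((d i : ℝ) - m₁ n k) / ((d i : ℝ) - m₁ n k * α)

lemma minimizerSq_pos (hα : α ≤ 1) {i : Fin n} (hi : m₁ n k < d i) :
    0 < minimizerSq k d α i :=
  div_pos (sub_pos.2 (by exact_mod_cast hi)) (sub_m₁_mul_pos hα hi)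

lemma minimizerSq_eq_zero {i : Fin n} (hi : m₁ n k = d i) : minimizerSq k d α i = 0 := by
  simp [minimizerSq, ← hi]

lemma minimizerSq_nonneg (hge : ∀ i, m₁ n k ≤ d i) (hα : α ≤ 1) (i : Fin n) :
    0 ≤ minimizerSq k d α i := by
  rcases (hge i).lt_or_eq with h | h
  · exact (minimizerSq_pos hα h).le
  · exact (minimizerSq_eq_zero h).ge

lemma sub_mul_minimizerSq (hge : ∀ i, m₁ n k ≤ d i) (hα : α ≤ 1) (i : Fin n) :
    ((d i : ℝ) - m₁ n k * α) * minimizerSq k d α i = (d i : ℝ) - m₁ n k := by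
  rcases (hge i).lt_or_eq with h | h
  · exact mul_div_cancel₀ _ (sub_m₁_mul_pos hα h).ne'
  · rw [minimizerSq_eq_zero h, ← h]; simp

lemma productBound_eq (hge : ∀ i, m₁ n k ≤ d i) {iStar : Fin n}
    (hi : IsLeast {i : Fin n | m₁ n k < d i} iStar) :
    productBound k d iStar α =
      α ^ m₁ n k * ∏ i, (minimizerSq k d α i)⁻¹ ^ (d i - m₁ n k) := by
  unfold productBound
  congr 1
  rw [Finset.prod_subset (Finset.subset_univ _)]
  · refine Finset.prod_congr rfl fun i _ => ?_
    rcases (hge i).lt_or_eq with h | h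
    · congr 1
      have h1 : (0 : ℝ) < (d i : ℝ) - m₁ n k := sub_pos.2 (by exact_mod_cast h)
      rw [minimizerSq, inv_div, eq_div_iff h1.ne', add_mul, div_mul_cancel₀ _ h1.ne']
      ring
    · simp [h]
  -- Before `iStar` the truncated exponent `d i - m₁` is zero.
  · intro i _ hi'
    have : ¬ m₁ n k < d i := fun h => hi' (Finset.mem_Ici.2 (hi.2 h))
    rw [Nat.sub_eq_zero_of_le (not_lt.1 this), pow_zero]

lemma sum_sub_add_m₁ (hn : k + 2 ≤ n) (hsum : ∑ i, d i = (k + 1) * m₃ n k)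
    (hge : ∀ i, m₁ n k ≤ d i) : m₁ n k + ∑ i, (d i - m₁ n k) = m₃ n k := by
  have h1 : ((∑ i, (d i - m₁ n k) : ℕ) : ℝ) = ((n - 2).choose k : ℕ) := by
    rw [← sum_sub_m₁ hn hsum]
    push_cast
    exact Finset.sum_congr rfl fun i _ => Nat.cast_sub (hge i)
  rw [← m₁_add hn]
  congr 1
  exact_mod_cast h1

lemma relaxedBound_eq (hge : ∀ i, m₁ n k ≤ d i) (x : Fin n → ℝ) :
    relaxedBound k d x = (∏ i, ((x i ^ 2) ^ (d i - m₁ n k))⁻¹) / (∑ i, x i ^ 2) ^ m₁ n k *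
      ((∑ i, (d i : ℝ) * x i ^ 2) / (m₃ n k : ℝ)) ^ m₃ n k := by
  unfold relaxedBound
  congr 2
  refine Finset.prod_congr rfl fun i _ => ?_
  rw [← zpow_natCast (x i ^ 2) (d i - m₁ n k), ← zpow_neg, Nat.cast_sub (hge i), neg_sub]

lemma sum_sq_pos (hex : ∃ i, m₁ n k < d i) {x : Fin n → ℝ} (hx : ∀ i, m₁ n k < d i → x i ≠ 0) :
    0 < ∑ i, x i ^ 2 := by
  obtain ⟨i, hi⟩ := hex
  exact Finset.sum_pos' (fun i _ => sq_nonneg _)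
    ⟨i, Finset.mem_univ _, sq_pos_of_ne_zero (hx i hi)⟩

/-- Weighted AM-GM, with `none` carrying the weight `m₁` of `α S`. The weights add up to `m₃`. -/
lemma le_relaxedBound (hn : k + 2 ≤ n) (hsum : ∑ i, d i = (k + 1) * m₃ n k)
    (hge : ∀ i, m₁ n k ≤ d i) (hα0 : 0 < α) (hα : α ≤ 1)
    {x : Fin n → ℝ} (hx : ∀ i, m₁ n k < d i → x i ≠ 0) :
    α ^ m₁ n k * ∏ i, (minimizerSq k d α i)⁻¹ ^ (d i - m₁ n k) ≤ relaxedBound k d x := by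
  have hS := sum_sq_pos (exists_m₁_lt hn hsum) hx
  set S := ∑ i, x i ^ 2 with hSdef
  have hm3 : (0 : ℝ) < m₃ n k := by exact_mod_cast m₃_pos hn
  let w : Option (Fin n) → ℕ := fun o => o.elim (m₁ n k) fun i => d i - m₁ n k
  let z : Option (Fin n) → ℝ := fun o => o.elim (α * S) fun i => x i ^ 2 * (minimizerSq k d α i)⁻¹
  have hw : ∑ o, w o = m₃ n k := by
    rw [Fintype.sum_option]; exact sum_sub_add_m₁ hn hsum hge
  have h1 := prod_pow_le_div_pow w z (by
    rintro (_ | i)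
    · exact mul_nonneg hα0.le hS.le
    · exact mul_nonneg (sq_nonneg _) (inv_nonneg.2 (minimizerSq_nonneg hge hα i)))
    (by rw [hw]; exact m₃_pos hn)
  rw [hw, Fintype.prod_option, Fintype.sum_option] at h1
  simp only [w, z, Option.elim] at h1
  -- The coefficients match exactly when `d_i > m₁`; when `d_i = m₁` the inverse of zero is zero,
  -- and `α ≤ 1` closes the gap.
  have h2 : (m₁ n k : ℝ) * (α * S) +
      ∑ i, ((d i - m₁ n k : ℕ) : ℝ) * (x i ^ 2 * (minimizerSq k d α i)⁻¹) ≤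
      ∑ i, (d i : ℝ) * x i ^ 2 := by
    rw [hSdef, Finset.mul_sum, Finset.mul_sum, ← Finset.sum_add_distrib]
    refine Finset.sum_le_sum fun i _ => ?_
    rcases (hge i).lt_or_eq with h | h
    · rw [Nat.cast_sub (hge i), ← sub_mul_minimizerSq hge hα i]
      have := (minimizerSq_pos hα h).ne'
      have h3 : ((d i : ℝ) - m₁ n k * α) * minimizerSq k d α i *
          (x i ^ 2 * (minimizerSq k d α i)⁻¹) = ((d i : ℝ) - m₁ n k * α) * x i ^ 2 := by
        field_simp
      rw [h3]
      linarith
    · rw [← h]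
      simp only [le_refl, tsub_eq_zero_of_le, Nat.cast_zero, zero_mul, add_zero]
      have h4 : α * x i ^ 2 ≤ x i ^ 2 := mul_le_of_le_one_left (sq_nonneg _) hα
      exact mul_le_mul_of_nonneg_left h4 (Nat.cast_nonneg _)
  have h3 : (α * S) ^ m₁ n k * ∏ i, (x i ^ 2 * (minimizerSq k d α i)⁻¹) ^ (d i - m₁ n k) ≤
      ((∑ i, (d i : ℝ) * x i ^ 2) / (m₃ n k : ℝ)) ^ m₃ n k := by
    refine h1.trans (pow_le_pow_left₀ (div_nonneg ?_ hm3.le)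
      ((div_le_div_iff_of_pos_right hm3).2 h2) _)
    refine add_nonneg (by positivity) (Finset.sum_nonneg fun i _ => ?_)
    exact mul_nonneg (Nat.cast_nonneg _)
      (mul_nonneg (sq_nonneg _) (inv_nonneg.2 (minimizerSq_nonneg hge hα i)))
  have hprod : 0 < ∏ i, (x i ^ 2) ^ (d i - m₁ n k) := by
    refine Finset.prod_pos fun i _ => ?_
    rcases (hge i).lt_or_eq with h | h
    · exact pow_pos (sq_pos_of_ne_zero (hx i h)) _
    · simp [h]
  rw [relaxedBound_eq hge, Finset.prod_inv_distrib, ← hSdef]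
  have h5 : (∏ i, (x i ^ 2) ^ (d i - m₁ n k))⁻¹ / S ^ m₁ n k *
      ((∑ i, (d i : ℝ) * x i ^ 2) / (m₃ n k : ℝ)) ^ m₃ n k =
      ((∑ i, (d i : ℝ) * x i ^ 2) / (m₃ n k : ℝ)) ^ m₃ n k /
        (S ^ m₁ n k * ∏ i, (x i ^ 2) ^ (d i - m₁ n k)) := by
    field_simp
  rw [h5, le_div_iff₀ (by positivity)]
  refine le_trans (le_of_eq ?_) h3
  simp only [mul_pow, Finset.prod_mul_distrib]
  ring

/-- At this point the equation for `α` gives `∑ x_i² = α⁻¹`, and then `∑ d_i x_i² = m₃`, so the last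
factor of the bound is 1. -/
lemma relaxedBound_minimizer (hn : k + 2 ≤ n) (hsum : ∑ i, d i = (k + 1) * m₃ n k)
    (hge : ∀ i, m₁ n k ≤ d i) (hα0 : 0 < α) (hα : α ≤ 1) (hsol : SolvesAlpha k d α) :
    relaxedBound k d (fun i => √(minimizerSq k d α i)) =
      α ^ m₁ n k * ∏ i, (minimizerSq k d α i)⁻¹ ^ (d i - m₁ n k) := by
  have hm3 : (0 : ℝ) < m₃ n k := by exact_mod_cast m₃_pos hn
  have hS : ∑ i, minimizerSq k d α i = α⁻¹ := hsol
  have hD : ∑ i, (d i : ℝ) * minimizerSq k d α i = m₃ n k := by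
    have h1 : ∀ i, (d i : ℝ) * minimizerSq k d α i =
        ((d i : ℝ) - m₁ n k) + m₁ n k * α * minimizerSq k d α i := by
      intro i; rw [← sub_mul_minimizerSq hge hα i]; ring
    have h2 : (m₁ n k : ℝ) + ((n - 2).choose k : ℕ) = m₃ n k := by exact_mod_cast m₁_add hn
    rw [Finset.sum_congr rfl fun i _ => h1 i, Finset.sum_add_distrib, ← Finset.mul_sum, hS,
      sum_sub_m₁ hn hsum, ← h2, mul_assoc, mul_inv_cancel₀ hα0.ne']
    ring
  rw [relaxedBound_eq hge]
  simp only [Real.sq_sqrt (minimizerSq_nonneg hge hα _), hS, hD, div_self hm3.ne', one_pow,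
    mul_one, inv_pow, div_inv_eq_mul]
  ring

lemma isLeast_relaxedBound (hn : k + 2 ≤ n) (hsum : ∑ i, d i = (k + 1) * m₃ n k)
    (hge : ∀ i, m₁ n k ≤ d i) (hα0 : 0 < α) (hα : α ≤ 1) (hsol : SolvesAlpha k d α) :
    IsLeast (relaxedBound k d '' {x | ∀ i, m₁ n k < d i → x i ≠ 0})
      (α ^ m₁ n k * ∏ i, (minimizerSq k d α i)⁻¹ ^ (d i - m₁ n k)) := by
  refine ⟨⟨_, fun i hi => ?_, relaxedBound_minimizer hn hsum hge hα0 hα hsol⟩, ?_⟩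
  · exact (Real.sqrt_pos.2 (minimizerSq_pos hα hi)).ne'
  · rintro _ ⟨x, hx, rfl⟩
    exact le_relaxedBound hn hsum hge hα0 hα hx

lemma isGLB_relaxedBound (hn : k + 2 ≤ n) (hsum : ∑ i, d i = (k + 1) * m₃ n k)
    (hge : ∀ i, m₁ n k ≤ d i) (hα0 : 0 < α) (hα : α ≤ 1) (hsol : SolvesAlpha k d α) :
    IsGLB (relaxedBound k d '' {x | ∀ i, x i ≠ 0})
      (α ^ m₁ n k * ∏ i, (minimizerSq k d α i)⁻¹ ^ (d i - m₁ n k)) := by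
  constructor
  · rintro _ ⟨x, hx, rfl⟩
    exact le_relaxedBound hn hsum hge hα0 hα fun i _ => hx i
  · intro b hb
    -- The minimizer vanishes where `d_i = m₁`. Those coordinates are perturbed to `ε > 0`; the
    -- bound stays continuous at `ε = 0` because their exponents are zero.
    let y : ℝ → Fin n → ℝ := fun ε i => if m₁ n k < d i then √(minimizerSq k d α i) else ε
    have hy0 : y 0 = fun i => √(minimizerSq k d α i) := by
      ext i
      simp only [y]
      split_ifs with h
      · rfl
      · rw [minimizerSq_eq_zero ((hge i).antisymm (not_lt.1 h)), Real.sqrt_zero]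
    have hyc : ∀ i, Continuous fun ε => y ε i := by
      intro i
      by_cases h : m₁ n k < d i
      · simp only [y, h, if_true]; exact continuous_const
      · simp only [y, h, if_false]; exact continuous_id
    have hyne : ∀ ε i, m₁ n k < d i → y ε i ≠ 0 := by
      intro ε i hi
      simp only [y, hi, if_true]
      exact (Real.sqrt_pos.2 (minimizerSq_pos hα hi)).ne'
    have hcont : Continuous fun ε => relaxedBound k d (y ε) := by
      simp only [relaxedBound_eq hge]
      refine Continuous.mul (Continuous.div ?_ (by fun_prop) fun ε => ?_) (by fun_prop)
      · refine continuous_finsetProd _ fun i _ => ?_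
        rcases (hge i).lt_or_eq with h | h
        · exact ((hyc i).pow 2 |>.pow _).inv₀ fun ε => pow_ne_zero _ (pow_ne_zero _ (hyne ε i h))
        · simp only [h, Nat.sub_self, pow_zero]; exact continuous_const
      · exact pow_ne_zero _ (sum_sq_pos (exists_m₁_lt hn hsum) (hyne ε)).ne'
    have hlim : Filter.Tendsto (fun ε => relaxedBound k d (y ε)) (nhdsWithin 0 (Set.Ioi 0))
        (nhds (α ^ m₁ n k * ∏ i, (minimizerSq k d α i)⁻¹ ^ (d i - m₁ n k))) := by
      rw [← relaxedBound_minimizer hn hsum hge hα0 hα hsol, ← hy0]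
      exact (hcont.tendsto 0).mono_left nhdsWithin_le_nhds
    refine ge_of_tendsto hlim ?_
    filter_upwards [self_mem_nhdsWithin] with ε hε
    refine hb ⟨y ε, fun i => ?_, rfl⟩
    by_cases h : m₁ n k < d i
    · exact hyne ε i h
    · simp only [y, h, if_false]; exact (Set.mem_Ioi.1 hε).ne'

lemma productBound_le (d : Fin n → ℕ) (hα0 : 0 < α) (hα : α ≤ 1)
    (hge : ∀ i, m₁ n k ≤ d i) (iStar : Fin n) :
    productBound k d iStar α ≤
      (α * Real.exp ((1 - α) * ((n : ℝ) - ((iStar : ℕ) + 1 : ℝ) + 1))) ^ m₁ n k := by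
  have hc : 0 ≤ (1 - α) * (m₁ n k : ℝ) := mul_nonneg (by linarith) (Nat.cast_nonneg _)
  have hp : ∀ i, 0 ≤ (d i : ℝ) - m₁ n k := fun i => sub_nonneg.2 (by exact_mod_cast hge i)
  have h1 : ∏ i ∈ Finset.Ici iStar,
      (1 + (1 - α) * (m₁ n k : ℝ) / ((d i : ℝ) - (m₁ n k : ℝ))) ^ (d i - m₁ n k) ≤
      ∏ i ∈ Finset.Ici iStar, Real.exp ((1 - α) * (m₁ n k : ℝ)) := by
    refine Finset.prod_le_prod (fun i _ => ?_) fun i _ => ?_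
    · exact pow_nonneg (add_nonneg zero_le_one (div_nonneg hc (hp i))) _
    · rcases (hge i).lt_or_eq with h | h
      · have h2 : (0 : ℝ) < (d i : ℝ) - m₁ n k := sub_pos.2 (by exact_mod_cast h)
        calc _ ≤ Real.exp ((1 - α) * (m₁ n k : ℝ) / ((d i : ℝ) - (m₁ n k : ℝ))) ^
              (d i - m₁ n k) := by
              refine pow_le_pow_left₀ (add_nonneg zero_le_one (div_nonneg hc (hp i))) ?_ _
              rw [add_comm]; exact Real.add_one_le_exp _
          _ = _ := by
              rw [← Real.exp_nat_mul, Nat.cast_sub (hge i), mul_div_cancel₀ _ h2.ne']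
      · rw [← h]; simpa using hc
  unfold productBound
  refine (mul_le_mul_of_nonneg_left h1 (pow_nonneg hα0.le _)).trans (le_of_eq ?_)
  -- Counting from 0, the interval has `n - iStar` elements, which is `n - i_* + 1` when counting
  -- from 1.
  rw [Finset.prod_const, Fin.card_Ici, mul_pow, ← Real.exp_nat_mul, ← Real.exp_nat_mul,
    Nat.cast_sub iStar.2.le]
  congr 2
  ring

/-- The inequality `α ≤ e^(α - 1)` cancels one factor `e^(1 - α)`. -/
lemma mul_exp_pow_le (hα0 : 0 < α) (m : ℕ) (r : ℝ) :
    (α * Real.exp ((1 - α) * (r + 1))) ^ m ≤ Real.exp ((1 - α) * r * m) := by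
  rw [mul_comm _ (m : ℝ), Real.exp_nat_mul]
  refine pow_le_pow_left₀ (by positivity) ?_ _
  have h1 : α ≤ Real.exp (α - 1) := by linarith [Real.add_one_le_exp (α - 1)]
  calc _ ≤ Real.exp (α - 1) * Real.exp ((1 - α) * (r + 1)) :=
        mul_le_mul_of_nonneg_right h1 (Real.exp_nonneg _)
    _ = _ := by rw [← Real.exp_add]; congr 1; ring

end Optimization

/-! ### The lower bound on degrees, and the bound for sorted degrees. -/

section Degrees

variable {n k : ℕ} {T : PreAbstractSimplicialComplex (Fin n)}

/-- If the degree of `i` were below `m₁`, then with `x_i → 0` and all other coordinates 1 the right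
side of the weighted inequality would vanish faster than the left, whose homology factor is at least
1. -/
lemma IsQAcyclic.m₁_le_degree (hT : IsQAcyclic T k) (hn : k + 2 ≤ n) (i : Fin n) :
    m₁ n k ≤ degree T k i := by
  by_contra! hlt
  have hm3 : (0 : ℝ) < m₃ n k := by exact_mod_cast m₃_pos hn
  -- `K` bounds the trace factor, since the degrees sum to `(k + 1) m₃` and every `x_j² ≤ 1`. With
  -- `ε K = 1/2` the inequality would give `1 ≤ 1/2`.
  set K : ℝ := ((k : ℝ) + 1) ^ m₃ n k with hK
  have hK1 : 1 ≤ K := one_le_pow₀ (by linarith [(Nat.cast_nonneg k : (0 : ℝ) ≤ k)])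
  set ε : ℝ := (2 * K)⁻¹ with hε
  have hε0 : 0 < ε := by positivity
  have hε1 : ε ≤ 1 := inv_le_one_of_one_le₀ (by linarith)
  have hεK : ε * K = 1 / 2 := by rw [hε]; field_simp
  have hε2 : ε ^ 2 ≤ ε := by nlinarith
  set x : Fin n → ℝ := Function.update (fun _ => 1) i ε with hxdef
  have hxi : x i = ε := Function.update_self _ _ _
  have hxj : ∀ j, j ≠ i → x j = 1 := fun j hj => Function.update_of_ne hj _ _
  have hx0 : ∀ j, x j ≠ 0 := by
    intro j
    rcases eq_or_ne j i with rfl | hj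
    · rw [hxi]; exact hε0.ne'
    · rw [hxj j hj]; exact one_ne_zero
  have hx1 : ∀ j, x j ^ 2 ≤ 1 := by
    intro j
    rcases eq_or_ne j i with rfl | hj
    · rw [hxi]; linarith
    · rw [hxj j hj]; simp
  have hprod : ∀ w : Fin n → ℕ, ∏ j, (x j ^ 2) ^ w j = (ε ^ 2) ^ w i := by
    intro w
    rw [Finset.prod_eq_single i (fun j _ hj => by rw [hxj j hj]; simp) (by simp), hxi]
  have h := hT.sq_card_reducedHomology_mul_le hn x hx0
  rw [hprod, hprod fun _ => m₁ n k] at h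
  have hs : 1 ≤ (∑ j, x j ^ 2) ^ m₁ n k := by
    refine one_le_pow₀ ?_
    have : Nontrivial (Fin n) := Fin.nontrivial_iff_two_le.2 (by omega)
    obtain ⟨j, hj⟩ := exists_ne i
    calc (1 : ℝ) = x j ^ 2 := by rw [hxj j hj]; simp
      _ ≤ _ := Finset.single_le_sum (f := fun j => x j ^ 2) (fun _ _ => sq_nonneg _)
        (Finset.mem_univ j)
  have hH : (1 : ℝ) ≤ (Nat.card (ReducedHomology ℤ T k) : ℝ) ^ 2 :=
    one_le_pow₀ (by exact_mod_cast hT.card_reducedHomology_pos i)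
  have hD : ((∑ j, (degree T k j : ℝ) * x j ^ 2) / m₃ n k) ^ m₃ n k ≤ K := by
    refine pow_le_pow_left₀ (by positivity) ?_ _
    rw [div_le_iff₀ hm3]
    calc _ ≤ ∑ j, (degree T k j : ℝ) :=
          Finset.sum_le_sum fun j _ => mul_le_of_le_one_right (Nat.cast_nonneg _) (hx1 j)
      _ = _ := by exact_mod_cast hT.sum_degree
  obtain ⟨c, hc⟩ : ∃ c, m₁ n k = degree T k i + (c + 1) :=
    ⟨m₁ n k - degree T k i - 1, by omega⟩
  have hpos : 0 < (ε ^ 2) ^ degree T k i := by positivity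
  have h1 : (ε ^ 2) ^ degree T k i * 1 ≤ (ε ^ 2) ^ degree T k i * ((ε ^ 2) ^ (c + 1) * K) := by
    calc _ ≤ (Nat.card (ReducedHomology ℤ T k) : ℝ) ^ 2 * (ε ^ 2) ^ degree T k i *
          (∑ j, x j ^ 2) ^ m₁ n k := by
          rw [mul_comm (_ ^ 2) ((ε ^ 2) ^ _), mul_assoc]
          refine mul_le_mul_of_nonneg_left ?_ hpos.le
          exact one_le_mul_of_one_le_of_one_le hH hs
      _ ≤ _ := h
      _ ≤ (ε ^ 2) ^ m₁ n k * K := mul_le_mul_of_nonneg_left hD (by positivity)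
      _ = _ := by rw [hc, pow_add, mul_assoc]
  have h2 := le_of_mul_le_mul_left h1 hpos
  have h3 : (ε ^ 2) ^ (c + 1) ≤ ε := by
    rw [pow_succ]
    calc _ ≤ 1 * ε := mul_le_mul (pow_le_one₀ (by positivity) (by linarith)) hε2
          (by positivity) zero_le_one
      _ = ε := one_mul _
  have h4 : (ε ^ 2) ^ (c + 1) * K ≤ ε * K := mul_le_mul_of_nonneg_right h3 (by linarith)
  linarith

lemma IsQAcyclic.sq_card_reducedHomology_le_relaxedBound (hT : IsQAcyclic T k) (hn : k + 2 ≤ n)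
    {d : Fin n → ℕ} (e : Equiv.Perm (Fin n)) (hde : ∀ i, d i = degree T k (e i))
    {x : Fin n → ℝ} (hx : ∀ i, x i ≠ 0) :
    (Nat.card (ReducedHomology ℤ T k) : ℝ) ^ 2 ≤ relaxedBound k d x := by
  have hge : ∀ i, m₁ n k ≤ d i := fun i => by rw [hde]; exact hT.m₁_le_degree hn _
  have h := hT.sq_card_reducedHomology_mul_le hn (x ∘ e.symm) fun i => hx _
  have hx2 : ∀ i, x i ^ 2 ≠ 0 := fun i => pow_ne_zero _ (hx i)
  rw [← Equiv.prod_comp e, ← Equiv.prod_comp e (fun i => ((x ∘ e.symm) i ^ 2) ^ m₁ n k),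
    ← Equiv.sum_comp e, ← Equiv.sum_comp e (fun i => (degree T k i : ℝ) * (x ∘ e.symm) i ^ 2)] at h
  simp only [Function.comp_apply, Equiv.symm_apply_apply, ← hde] at h
  have hS : 0 < ∑ i, x i ^ 2 :=
    Finset.sum_pos (fun i _ => sq_pos_of_ne_zero (hx i)) ⟨⟨0, by omega⟩, Finset.mem_univ _⟩
  have hP : 0 < ∏ i, (x i ^ 2) ^ d i :=
    Finset.prod_pos fun i _ => pow_pos (sq_pos_of_ne_zero (hx i)) _
  have hz : ∏ i, (x i ^ 2) ^ ((m₁ n k : ℤ) - (d i : ℤ)) =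
      (∏ i, (x i ^ 2) ^ m₁ n k) / ∏ i, (x i ^ 2) ^ d i := by
    rw [← Finset.prod_div_distrib]
    refine Finset.prod_congr rfl fun i _ => ?_
    rw [zpow_sub₀ (hx2 i), zpow_natCast, zpow_natCast]
  rw [relaxedBound, hz, div_div, div_mul_eq_mul_div, le_div_iff₀ (by positivity), ← mul_assoc]
  exact h

end Degrees

end TorsionBound

open TorsionBound in
/-- `d` lists the vertex degrees of `T` in increasing order. The first index `i_*` with
`d i > m₁` is the element `iStar` of `Fin n`, so that `i_* = iStar + 1` when counting from 1. -/
theorem corollary5 (n k : ℕ) (hk : k + 2 ≤ n)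
    (T : PreAbstractSimplicialComplex (Fin n)) (hT : TorsionBound.IsQAcyclic T k)
    (d : Fin n → ℕ) (e : Equiv.Perm (Fin n))
    (hde : ∀ i, d i = TorsionBound.degree T k (e i)) (hd : Monotone d) :
    Finite (TorsionBound.ReducedHomology ℤ T k) ∧
    ∃ iStar : Fin n, IsLeast {i : Fin n | TorsionBound.m₁ n k < d i} iStar ∧
      Set.Icc ((d iStar : ℝ) / (TorsionBound.m₃ n k : ℝ))
          ((d ⟨n - 1, by omega⟩ : ℝ) / (TorsionBound.m₃ n k : ℝ)) ⊆
        Set.Ioc ((k : ℝ) / ((n : ℝ) - 1)) 1 ∧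
      ∃ α ∈ Set.Icc ((d iStar : ℝ) / (TorsionBound.m₃ n k : ℝ))
          ((d ⟨n - 1, by omega⟩ : ℝ) / (TorsionBound.m₃ n k : ℝ)),
        TorsionBound.SolvesAlpha k d α ∧
        (∀ β ∈ Set.Ioc ((k : ℝ) / ((n : ℝ) - 1)) 1, TorsionBound.SolvesAlpha k d β → β = α) ∧
        (Nat.card (TorsionBound.ReducedHomology ℤ T k) : ℝ) ^ 2 ≤
          TorsionBound.productBound k d iStar α ∧
        TorsionBound.productBound k d iStar α ≤
          (α * Real.exp ((1 - α) * ((n : ℝ) - ((iStar : ℕ) + 1 : ℝ) + 1))) ^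
            TorsionBound.m₁ n k ∧
        (α * Real.exp ((1 - α) * ((n : ℝ) - ((iStar : ℕ) + 1 : ℝ) + 1))) ^
            TorsionBound.m₁ n k ≤
          Real.exp ((1 - α) * ((n : ℝ) - ((iStar : ℕ) + 1 : ℝ)) * (TorsionBound.m₁ n k : ℝ)) ∧
        IsGLB (TorsionBound.relaxedBound k d '' {x | ∀ i, x i ≠ 0})
          (TorsionBound.productBound k d iStar α) ∧
        IsLeast (TorsionBound.relaxedBound k d '' {x | ∀ i, TorsionBound.m₁ n k < d i → x i ≠ 0})
          (TorsionBound.productBound k d iStar α) := by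
  have hsum : ∑ i, d i = (k + 1) * m₃ n k := by
    rw [← hT.sum_degree, ← Equiv.sum_comp e (degree T k)]
    exact Finset.sum_congr rfl fun i _ => hde i
  have hge : ∀ i, m₁ n k ≤ d i := fun i => by rw [hde]; exact hT.m₁_le_degree hk _
  have hle : ∀ i, d i ≤ m₃ n k := fun i => by rw [hde]; exact hT.degree_le _
  have hex := exists_m₁_lt hk hsum
  obtain ⟨iStar, hi, hmin⟩ := wellFounded_lt.has_min {i : Fin n | m₁ n k < d i} hex
  have hleast : IsLeast {i : Fin n | m₁ n k < d i} iStar :=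
    ⟨hi, fun j hj => not_lt.1 (hmin j hj)⟩
  have hm3 : (0 : ℝ) < m₃ n k := by exact_mod_cast m₃_pos hk
  have hn1 : (0 : ℝ) < (n : ℝ) - 1 := by
    have : ((k + 2 : ℕ) : ℝ) ≤ n := by exact_mod_cast hk
    push_cast at this
    linarith [(Nat.cast_nonneg k : (0 : ℝ) ≤ k)]
  have hlast : ∀ i : Fin n, d i ≤ d ⟨n - 1, by omega⟩ := fun i =>
    hd (Fin.le_def.2 (Nat.le_sub_one_of_lt i.2))
  have hsub : Set.Icc ((d iStar : ℝ) / (m₃ n k : ℝ)) ((d ⟨n - 1, by omega⟩ : ℝ) / (m₃ n k : ℝ)) ⊆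
      Set.Ioc ((k : ℝ) / ((n : ℝ) - 1)) 1 := by
    rintro a ⟨h1, h2⟩
    refine ⟨lt_of_lt_of_le ?_ h1, h2.trans ?_⟩
    -- The left endpoint `k/(n - 1)` is `m₁/m₃`, so the claim is `m₁ < d iStar`.
    · rw [div_lt_div_iff₀ hn1 hm3, mul_m₃ hk, mul_comm]
      exact mul_lt_mul_of_pos_right (by exact_mod_cast hi) hn1
    · rw [div_le_one hm3]; exact_mod_cast hle _
  have hpos : ∀ a ∈ Set.Ioc ((k : ℝ) / ((n : ℝ) - 1)) 1, 0 < a := fun a ha =>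
    lt_of_le_of_lt (div_nonneg (Nat.cast_nonneg k) hn1.le) ha.1
  have hab : (d iStar : ℝ) / (m₃ n k : ℝ) ≤ (d ⟨n - 1, by omega⟩ : ℝ) / (m₃ n k : ℝ) :=
    (div_le_div_iff_of_pos_right hm3).2 (by exact_mod_cast hlast iStar)
  have ha := hsub (Set.left_mem_Icc.2 hab)
  have hb := hsub (Set.right_mem_Icc.2 hab)
  obtain ⟨α, hα, hsol⟩ := exists_solvesAlpha hk hsum hge (hpos _ ha) hab hb.2
    (fun i h => (div_le_div_iff_of_pos_right hm3).2 (by exact_mod_cast hd (hleast.2 h)))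
    (fun i => (div_le_div_iff_of_pos_right hm3).2 (by exact_mod_cast hlast i))
  have hα0 := hpos α (hsub hα)
  have hα1 := (hsub hα).2
  have heq := productBound_eq (α := α) hge hleast
  have hglb := isGLB_relaxedBound hk hsum hge hα0 hα1 hsol
  have hmin' := isLeast_relaxedBound hk hsum hge hα0 hα1 hsol
  rw [← heq] at hglb hmin'
  refine ⟨Nat.finite_of_card_ne_zero (hT.card_reducedHomology_pos iStar).ne', iStar, hleast, hsub,
    α, hα, hsol, fun β hβ hβs => hsol.unique hge hex hα0 hα1 (hpos β hβ) hβ.2 hβs, ?_,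
    productBound_le d hα0 hα1 hge iStar, mul_exp_pow_le hα0 _ _, hglb, hmin'⟩
  -- The bound by `f` was proved only for `x` without zero coordinates, so it passes to the infimum
  -- over these.
  refine hglb.2 ?_
  rintro _ ⟨x, hx, rfl⟩
  exact hT.sq_card_reducedHomology_le_relaxedBound hk e hde hx
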